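/- Let $\mathcal D$ and $\mathcal A$ be unital $C^*$-algebras, with $\mathcal D$ a unital $*$-subalgebra of $\mathcal A$, and let $\mathbb E^{\mathcal D}:\mathcal A\to\mathcal D$ be a conditional expectation (linear, positive, $\mathbb E^{\mathcal D}[1]=1$, $\mathbb E^{\mathcal D}[\Delta_1a\Delta_2]=\Delta_1\mathbb E^{\mathcal D}[a]\Delta_2$ for $\Delta_1,\Delta_2\in\mathcal D$). Let $\sigma_\epsilon:\mathcal D\to\mathcal D$ be a completely positive map and let $(X_t)_{t\ge0}\subset\mathcal A$ be a $\mathcal D$-valued semicircular free Brownian motion of variance $\sigma_\epsilon$: $X_t^*=X_t$, $X_0=0$; for $0\le s\le t$ the increment $X_t-X_s$ is a centred $\mathcal D$-valued semicircular element of variance $\Delta\mapsto(t-s)\sigma_\epsilon(\Delta)$, i.e. its $\mathcal D$-valued moments are the sums over non-crossing pairings of the nested products of this variance; and the increments over disjoint intervals generate, together with $\mathcal D$, subalgebras that are mutually free over $\mathcal D$. Let $\mathcal A_t$ be the closed $*$-algebra generated by $\mathcal D$ and $\{X_s: s\le t\}$. Let $t\mapsto U_t\in\mathcal A_t$ be a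 norm-continuous solution of $$U_t=1+i\int_0^t(\mathrm dX_s)\,U_s-\frac{\sigma_\epsilon(1)}2\int_0^tU_s\,\mathrm ds ,$$ where the stochastic integral is the norm limit of the sums $\sum_k(X_{t_{k+1}}-X_{t_k})U_{t_k}$ over partitions of $[0,t]$ as the mesh tends to $0$. For $\phi_0\in\mathcal D$ let $\phi_t=U_t\phi_0U_t^{-1}$ be the flow on the adjoint orbit of $\phi_0$, where $U_t^{-1}$ is read either as a two-sided inverse of $U_t$ (supposed to exist for all $t\geq 0$) or, for all $t\geq 0$, as $U_t^*$ (with nothing further supposed); the result holds with both readings. For $p\ge0$ and $\Delta_1,\dots,\Delta_p\in\mathcal D$ put $C^t_{p+1}[\Delta_1,\dots,\Delta_p]:=\mathbb E^{\mathcal D}[\phi_t\Delta_1\phi_t\cdots\Delta_p\phi_t]$, and for $\Delta,d_1,d_2\in\mathcal D$ put $$L_\epsilon(\Delta):=\sigma_\epsilon(\Delta)-\tfrac12\big(\sigma_\epsilon(1)\Delta+\Delta\sigma_\epsilon(1)\big),$$ $$\mathfrak L_\epsilon(\Delta;d_1,d_2):=\tfrac12\big(L_\epsilon(d_1\Delta)d_2-L_\epsilon(d_1)\Delta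 d_2+d_1L_\epsilon(\Delta d_2)-d_1\Delta L_\epsilon(d_2)\big),$$ $$\mathfrak D_\epsilon(d_1,d_2;\Delta):=\tfrac12\big(L_\epsilon(d_1\Delta d_2)-d_1L_\epsilon(\Delta d_2)-L_\epsilon(d_1\Delta)d_2+d_1L_\epsilon(\Delta)d_2\big).$$ Then for all $p\ge0$, all $\Delta_1,\dots,\Delta_p\in\mathcal D$ and all $t\ge0$, the map $t\mapsto C^t_{p+1}[\Delta_1,\dots,\Delta_p]$ is differentiable in the norm of $\mathcal D$ (from the right at $t=0$), and $$\begin{aligned}\partial_tC^t_{p+1}[\Delta_1,\dots,\Delta_p]={}&L_\epsilon\big(C^t_{p+1}[\Delta_1,\dots,\Delta_p]\big)+\sum_{j=1}^pC^t_{p+1}[\Delta_1,\dots,L_\epsilon(\Delta_j),\dots,\Delta_p]\\&-2\sum_{j=1}^p\mathfrak L_\epsilon\big(\Delta_j;\,C^t_j[\Delta_1,\dots,\Delta_{j-1}],\,C^t_{p+1-j}[\Delta_{j+1},\dots,\Delta_p]\big)\\&+2\sum_{1\le j<k\le p}C^t_{p+1-k+j}\big[\Delta_1,\dots,\Delta_{j-1},\,\mathfrak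 D_\epsilon\big(\Delta_j,\Delta_k;\,C^t_{k-j}[\Delta_{j+1},\dots,\Delta_{k-1}]\big),\,\Delta_{k+1},\dots,\Delta_p\big].\end{aligned}$$ This hierarchy is closed and triangular: the first line of the right-hand side depends on the moments only through $C^t_{p+1}$, and the last two lines only through $C^t_1,\dots,C^t_p$. -/

import Mathlib

open Filter Topology Set
open scoped CStarAlgebra

noncomputable section

namespace FreeOrbit

section Lindblad

variable {D : Type*} [CStarAlgebra D]

/-- The Lindbladian `L(Δ) = σ(Δ) - (σ(1) Δ + Δ σ(1)) / 2` of a map `σ : D → D`. -/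
def lindbladian (σ : D → D) (Δ : D) : D :=
  σ Δ - (1 / 2 : ℂ) • (σ 1 * Δ + Δ * σ 1)

/-- The dressed Lindbladian `𝔏(Δ; d₁, d₂)`. -/
def dressedLindbladian (L : D → D) (Δ d₁ d₂ : D) : D :=
  (1 / 2 : ℂ) • (L (d₁ * Δ) * d₂ - L d₁ * Δ * d₂ + d₁ * L (Δ * d₂) - d₁ * Δ * L d₂)

/-- The operator `𝔇(d₁, d₂; Δ)`. -/
def dressedDefect (L : D → D) (d₁ d₂ Δ : D) : D :=
  (1 / 2 : ℂ) • (L (d₁ * Δ * d₂) - d₁ * L (Δ * d₂) - L (d₁ * Δ) * d₂ + d₁ * L Δ * d₂)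

/-! A family of moments `(C_{p+1})_{p ≥ 0}` is encoded as one function `C : List D → D`, with
`C_{p+1}[Δ₁, …, Δ_p] = C [Δ₁, …, Δ_p]`. List positions are counted from `0`: the entry `Δ[j]` is
`Δ_{j+1}`, and `Δ.take j`, `Δ.drop (j + 1)` are the entries strictly before and after it. -/

/-- The terms that are linear in `C_{p+1}`:
`L(C_{p+1}[Δ₁, …, Δ_p]) + ∑_j C_{p+1}[Δ₁, …, L(Δ_j), …, Δ_p]`. -/
def linearPart (L : D → D) (C : List D → D) (Δ : List D) : D :=
  L (C Δ) + ∑ j : Fin Δ.length, C (Δ.set j (L Δ[j]))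

/-- The nonlinear terms:
`- 2 ∑_j 𝔏(Δ_j; C_j[Δ₁, …, Δ_{j-1}], C_{p+1-j}[Δ_{j+1}, …, Δ_p])
 + 2 ∑_{j<k} C_{p+1-k+j}[Δ₁, …, Δ_{j-1}, 𝔇(Δ_j, Δ_k; C_{k-j}[Δ_{j+1}, …, Δ_{k-1}]), Δ_{k+1}, …]`. -/
def nonlinearPart (L : D → D) (C : List D → D) (Δ : List D) : D :=
  - (2 : ℂ) • ∑ j : Fin Δ.length,
      dressedLindbladian L Δ[j] (C (Δ.take j)) (C (Δ.drop (j + 1)))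
  + (2 : ℂ) • ∑ j : Fin Δ.length, ∑ k : Fin Δ.length,
      if j < k then
        C (Δ.take j ++
          dressedDefect L Δ[j] Δ[k] (C ((Δ.take k).drop (j + 1))) :: Δ.drop (k + 1))
      else 0

end Lindblad

section Words

variable {D A : Type*} [CStarAlgebra D] [CStarAlgebra A]

/-- The word `a Δ₁ a Δ₂ a ⋯ Δ_p a`. -/
def word (ι : D →⋆ₐ[ℂ] A) (a : A) : List D → A
  | [] => a
  | d :: ds => a * ι d * word ι a ds

/-- A non-crossing pairing of `2m` ordered points is coded by a planar binary tree with `m` nodes: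
the first point is paired with some later point, the left subtree is the pairing of the points
between the two, and the right subtree is the pairing of the points after the second one.
For the letters `d₀ S d₁ S ⋯ S d_{2m}`, `pairingValue η T [d₀, …, d_{2m}]` is the nested product
of the variance `η` along the pairing `T`; each pair contributes `S b S ↦ η(b)`. -/
def pairingValue (η : D → D) : BinaryTree Unit → List D → D
  | .nil, ds => ds.headD 1
  | .node _ l r, ds =>
      ds.headD 1 * η (pairingValue η l (ds.tail.take (2 * l.numNodes + 1)))
        * pairingValue η r (ds.tail.drop (2 * l.numNodes + 1))

end Words

section Probability

variable {D A : Type*} [CStarAlgebra D] [PartialOrder D] [StarOrderedRing D]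
  [CStarAlgebra A] [PartialOrder A] [StarOrderedRing A]

/-- `E : A → D` is a (positive, unital) conditional expectation onto the subalgebra `ι(D)`. -/
structure IsCondExp (ι : D →⋆ₐ[ℂ] A) (E : A →ₚ[ℂ] D) : Prop where
  map_one : E 1 = 1
  bimodule : ∀ (d₁ : D) (a : A) (d₂ : D), E (ι d₁ * a * ι d₂) = d₁ * E a * d₂

/-- Freeness over `D` of a family of subalgebras: alternating products of centred elements are
centred. -/
def FreeOver {I : Type*} (E : A →ₚ[ℂ] D) (S : I → StarSubalgebra ℂ A) : Prop :=
  ∀ (n : ℕ) (i : Fin (n + 1) → I) (a : Fin (n + 1) → A),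
    (∀ k, a k ∈ S (i k)) → (∀ k, E (a k) = 0) →
    (∀ k : Fin n, i k.castSucc ≠ i k.succ) → E (List.ofFn a).prod = 0

/-- `S` is a centred `D`-valued semicircular element of variance `η`: its `D`-valued moments of odd
order vanish and those of order `2m` are the sums over the non-crossing pairings of `2m` points.
The word `S d₁ S ⋯ d_p S` has `p + 1` letters `S`. -/
def IsSemicircular (ι : D →⋆ₐ[ℂ] A) (E : A →ₚ[ℂ] D) (η : D → D) (S : A) : Prop :=
  ∀ ds : List D, E (word ι S ds) =
    if Even (ds.length + 1) then
      ∑ T ∈ BinaryTree.treesOfNumNodesEq ((ds.length + 1) / 2), pairingValue η T (1 :: ds ++ [1])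
    else 0

/-- `X` is a `D`-valued semicircular free Brownian motion of variance `σ`: self-adjoint, starting
at `0`, with centred semicircular increments of variance `(t - s) σ`, such that increments over
disjoint intervals generate, together with `D`, subalgebras that are free over `D`.
Only the values at times `t ≥ 0` matter. -/
structure IsFreeBrownianMotion (ι : D →⋆ₐ[ℂ] A) (E : A →ₚ[ℂ] D) (σ : D →CP D) (X : ℝ → A) :
    Prop where
  selfAdjoint : ∀ t, 0 ≤ t → IsSelfAdjoint (X t)
  zero : X 0 = 0
  semicircular : ∀ s t, 0 ≤ s → s ≤ t →
    IsSemicircular ι E (fun Δ => ((t - s : ℝ) : ℂ) • σ Δ) (X t - X s)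
  free : ∀ τ : ℕ → ℝ, Monotone τ → 0 ≤ τ 0 →
    FreeOver E fun k => StarAlgebra.adjoin ℂ (range ι ∪ {X (τ (k + 1)) - X (τ k)})

/-- The algebra `𝒜_t`: the closed `*`-algebra generated by `D` and the `X_s`, `0 ≤ s ≤ t`. -/
def filtration (ι : D →⋆ₐ[ℂ] A) (X : ℝ → A) (t : ℝ) : StarSubalgebra ℂ A :=
  (StarAlgebra.adjoin ℂ (range ι ∪ X '' Icc 0 t)).topologicalClosure

/-- `∫₀ᵗ F_s (dX_s) G_s = I`: the sums `∑_k F_{τ_k} (X_{τ_{k+1}} - X_{τ_k}) G_{τ_k}` over the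
partitions `0 = τ₀ ≤ ⋯ ≤ τ_n = t` converge to `I` in norm as the mesh goes to `0`. -/
def HasFreeIntegral (X F G : ℝ → A) (t : ℝ) (I : A) : Prop :=
  ∀ ε > 0, ∃ δ > 0, ∀ (n : ℕ) (τ : ℕ → ℝ), Monotone τ → τ 0 = 0 → τ n = t →
    (∀ k < n, τ (k + 1) - τ k < δ) →
    ‖∑ k ∈ Finset.range n, F (τ k) * (X (τ (k + 1)) - X (τ k)) * G (τ k) - I‖ < ε

/-- `U` is a continuous adapted solution of
`U_t = 1 + i ∫₀ᵗ (dX_s) U_s - (σ(1) / 2) ∫₀ᵗ U_s ds`. -/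
structure IsEvolution (ι : D →⋆ₐ[ℂ] A) (σ : D →CP D) (X U : ℝ → A) : Prop where
  continuousOn : ContinuousOn U (Ici 0)
  adapted : ∀ t, 0 ≤ t → U t ∈ filtration ι X t
  sde : ∀ t, 0 ≤ t → ∃ I : A, HasFreeIntegral X (fun _ => 1) U t I ∧
    U t = 1 + Complex.I • I - (1 / 2 : ℂ) • (ι (σ 1) * ∫ s in (0 : ℝ)..t, U s)

/-- `φ` is the flow `φ_t = U_t φ₀ U_t⁻¹` on the adjoint orbit of `φ₀`. Here `U_t⁻¹` may be either a
two-sided inverse of `U_t` or the adjoint `U_t^*`; the two are the same for unitary `U_t`, and with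
the second reading nothing is presupposed about `U_t`. -/
def IsOrbitFlow (ι : D →⋆ₐ[ℂ] A) (U : ℝ → A) (φ₀ : D) (φ : ℝ → A) : Prop :=
  ∃ V : ℝ → A,
    ((∀ t, 0 ≤ t → U t * V t = 1 ∧ V t * U t = 1) ∨ (∀ t, 0 ≤ t → V t = star (U t))) ∧
    ∀ t, 0 ≤ t → φ t = U t * ι φ₀ * V t

/-- The `D`-valued moments `C^t_{p+1}[Δ₁, …, Δ_p] = E[φ_t Δ₁ φ_t ⋯ Δ_p φ_t]`. -/
def moment (ι : D →⋆ₐ[ℂ] A) (E : A →ₚ[ℂ] D) (φ : ℝ → A) (t : ℝ) (Δ : List D) : D :=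
  E (word ι (φ t) Δ)

end Probability

end FreeOrbit

end

/-! The proof is an Itô calculus in which all limits are taken under `E`. Let `y` be the increment
of `X` over `[s, t]` and let `a, b, c` belong to the past of `s`. Freeness gives `E (a y c) = 0` and
`E (a y b y c) = (t - s) E (a σ(E b) c)` (`map_increment`, `map_increment_sq`). In a product of two
Riemann sums only the diagonal terms then survive, and the resulting estimate, being a closed
condition, passes to the stochastic integral (`isSlope_integral₂`). This is the Itô table for the
martingale part of `U`.

No rate in operator norm is needed for the martingale increments. Errors are measured by `‖E (x
x*)‖` and `‖E (x* x)‖`, with coefficients from the past. There the increments are `O(√(s - t))`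
(`IsSmall`), products of two of them and all drift terms are `o(√(s - t))` (`IsNegligible`), and a
substitute for the Cauchy–Schwarz inequality (`norm_map_mul_le_add_smul`) shows that negligible
parts do not affect the slope of a two-increment term (`isLittleO_map_bilin`). `HasExpansion`
records what is needed of `U` and of the factor `V` on the right of the flow. It holds for `V = U*`
and for `V = U⁻¹`, so both readings are handled by one argument.

A word in `φ_s` is expanded exactly to second order around `φ_t` (`word_sub_word_eq`), which gives a
right derivative `flowSlope` of each moment. The rest is bookkeeping: `σ` acts on the moment of the
piece of the word between two contracted letters, and sorting the pairs of letters by whether they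
are interior, at an end of the word, or adjacent yields the four kinds of terms of the hierarchy
(`flowSlope_eq`). Since `flowSlope` is continuous in `φ`, the right derivative is a derivative. -/

noncomputable section

namespace FreeOrbit

set_option linter.unusedSectionVars false

/-! ### Freeness over `D`: past words around one centred future letter. -/

section Freeness

variable {D A : Type*} [CStarAlgebra D] [PartialOrder D] [StarOrderedRing D]
  [CStarAlgebra A] [PartialOrder A] [StarOrderedRing A]
  {ι : D →⋆ₐ[ℂ] A} {E : A →ₚ[ℂ] D} {S : ℕ → StarSubalgebra ℂ A} {m : ℕ}

namespace IsCondExp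

lemma map_coe (hE : IsCondExp ι E) (d : D) : E (ι d) = d := by
  simpa [hE.map_one] using hE.bimodule d 1 1

lemma map_coe_mul (hE : IsCondExp ι E) (d : D) (a : A) : E (ι d * a) = d * E a := by
  simpa using hE.bimodule d a 1

lemma map_mul_coe (hE : IsCondExp ι E) (a : A) (d : D) : E (a * ι d) = E a * d := by
  simpa using hE.bimodule 1 a d

end IsCondExp

/-- Lists of centred elements of the algebras `S i` in which consecutive indices differ. -/
def IsAlternating (E : A →ₚ[ℂ] D) (S : ℕ → StarSubalgebra ℂ A) (l : List (ℕ × A)) : Prop :=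
  (∀ p ∈ l, p.2 ∈ S p.1 ∧ E p.2 = 0) ∧ l.IsChain (fun p q => p.1 ≠ q.1)

lemma FreeOver.map_prod_eq_zero (hS : FreeOver E S) {l : List (ℕ × A)}
    (hl : IsAlternating E S l) (hne : l ≠ []) : E (l.map Prod.snd).prod = 0 := by
  obtain ⟨n, hn⟩ : ∃ n, l.length = n + 1 :=
    Nat.exists_eq_succ_of_ne_zero (by simpa using hne)
  have key := hS n (fun k => (l[k.1]'(by omega)).1) (fun k => (l[k.1]'(by omega)).2)
    (fun k => (hl.1 _ (List.getElem_mem _)).1) (fun k => (hl.1 _ (List.getElem_mem _)).2)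
    (fun k => by
      have := List.isChain_iff_getElem.1 hl.2 k.1 (by have := k.2; omega)
      simpa using this)
  convert key using 3
  apply List.ext_getElem
  · simp [hn]
  · intro i h1 h2
    rw [List.getElem_ofFn, List.getElem_map]

/-- The span of `D` and of the alternating centred words in the algebras of index `< m`. -/
def altSpan (ι : D →⋆ₐ[ℂ] A) (E : A →ₚ[ℂ] D) (S : ℕ → StarSubalgebra ℂ A) (m : ℕ) :
    Submodule ℂ A :=
  Submodule.span ℂ (range ι ∪ {x | ∃ l : List (ℕ × A), l ≠ [] ∧ IsAlternating E S l ∧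
    (∀ p ∈ l, p.1 < m) ∧ x = (l.map Prod.snd).prod})

lemma coe_mem_altSpan (d : D) : ι d ∈ altSpan ι E S m :=
  Submodule.subset_span (Or.inl ⟨d, rfl⟩)

lemma prod_mem_altSpan {l : List (ℕ × A)} (hl : IsAlternating E S l) (hm : ∀ p ∈ l, p.1 < m) :
    (l.map Prod.snd).prod ∈ altSpan ι E S m := by
  rcases eq_or_ne l [] with rfl | hne
  · simpa using coe_mem_altSpan (ι := ι) (E := E) (S := S) (m := m) 1
  · exact Submodule.subset_span (Or.inr ⟨l, hne, hl, hm, rfl⟩)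

lemma IsAlternating.tail {p : ℕ × A} {l : List (ℕ × A)} (h : IsAlternating E S (p :: l)) :
    IsAlternating E S l :=
  ⟨fun q hq => h.1 q (List.mem_cons_of_mem _ hq), h.2.tail⟩

lemma IsAlternating.replace_head {i : ℕ} {a b : A} {l : List (ℕ × A)}
    (h : IsAlternating E S ((i, a) :: l)) (hb : b ∈ S i) (hb0 : E b = 0) :
    IsAlternating E S ((i, b) :: l) := by
  refine ⟨?_, ?_⟩
  · intro q hq
    rcases List.mem_cons.1 hq with rfl | hq
    · exact ⟨hb, hb0⟩
    · exact h.1 q (List.mem_cons_of_mem _ hq)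
  · have := h.2
    rw [List.isChain_cons] at this ⊢
    exact this

lemma IsAlternating.cons {i : ℕ} {b : A} {l : List (ℕ × A)}
    (h : IsAlternating E S l) (hb : b ∈ S i) (hb0 : E b = 0)
    (hi : ∀ p ∈ l.head?, i ≠ p.1) : IsAlternating E S ((i, b) :: l) := by
  refine ⟨?_, ?_⟩
  · intro q hq
    rcases List.mem_cons.1 hq with rfl | hq
    · exact ⟨hb, hb0⟩
    · exact h.1 q hq
  · rw [List.isChain_cons]
    exact ⟨hi, h.2⟩

lemma center_mem (hS : ∀ i d, ι d ∈ S i) {i : ℕ} {a : A} (ha : a ∈ S i) : a - ι (E a) ∈ S i :=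
  sub_mem ha (hS i _)

lemma IsCondExp.map_center (hE : IsCondExp ι E) (a : A) : E (a - ι (E a)) = 0 := by
  simp [hE.map_coe]

/-- Put a new letter in front of an alternating word. If its index equals that of the first letter,
merge the two. Then split the new first letter into its centred part, which keeps the word
alternating, and its mean in `D`, which the following letter absorbs without losing centredness, by
the bimodule property. -/
lemma mul_mem_altSpan (hE : IsCondExp ι E) (hS : ∀ i d, ι d ∈ S i) {i : ℕ} (hi : i < m)
    {s w : A} (hs : s ∈ S i) (hw : w ∈ altSpan ι E S m) : s * w ∈ altSpan ι E S m := by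
  have hsing : ∀ a ∈ S i, a ∈ altSpan ι E S m := by
    intro a ha
    have h1 : a = (a - ι (E a)) + ι (E a) := by abel
    rw [h1]
    refine add_mem ?_ (coe_mem_altSpan _)
    have := prod_mem_altSpan (ι := ι) (E := E) (S := S) (m := m) (l := [(i, a - ι (E a))])
      ⟨by simpa using ⟨center_mem hS ha, by simp [hE.map_coe]⟩, by simp⟩ (by simpa using hi)
    simpa using this
  unfold altSpan at hw
  induction hw using Submodule.span_induction with
  | mem x hx =>
    rcases hx with ⟨d, rfl⟩ | ⟨l, hne, hl, hm, rfl⟩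
    · exact hsing _ (mul_mem hs (hS i d))
    · obtain ⟨⟨j, a⟩, l, rfl⟩ := List.exists_cons_of_ne_nil hne
      have ha : a ∈ S j ∧ E a = 0 := hl.1 (j, a) (by simp)
      have hml : ∀ p ∈ l, p.1 < m := fun p hp => hm p (List.mem_cons_of_mem _ hp)
      have hj : j < m := hm (j, a) (by simp)
      rw [List.map_cons, List.prod_cons]
      have hD : ∀ d : D, ι d * (l.map Prod.snd).prod ∈ altSpan ι E S m := by
        intro d
        rcases l with _ | ⟨⟨k, b⟩, l⟩
        · simpa using coe_mem_altSpan d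
        · have hb : b ∈ S k ∧ E b = 0 := hl.1 (k, b) (by simp)
          have := prod_mem_altSpan (ι := ι) (E := E) (S := S) (m := m)
            (l := (k, ι d * b) :: l)
            (hl.tail.replace_head (mul_mem (hS k d) hb.1) (by simp [hE.map_coe_mul, hb.2]))
            (by intro p hp
                rcases List.mem_cons.1 hp with rfl | hp
                · exact hml (k, b) (by simp)
                · exact hml p (List.mem_cons_of_mem _ hp))
          simpa [mul_assoc] using this
      by_cases hij : i = j
      · subst hij
        have h1 : s * (a * (l.map Prod.snd).prod) =
            (s * a - ι (E (s * a))) * (l.map Prod.snd).prod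
              + ι (E (s * a)) * (l.map Prod.snd).prod := by noncomm_ring
        rw [h1]
        refine add_mem ?_ (hD _)
        have := prod_mem_altSpan (ι := ι) (E := E) (S := S) (m := m)
          (l := (i, s * a - ι (E (s * a))) :: l)
          (hl.replace_head (center_mem hS (mul_mem hs ha.1)) (hE.map_center _))
          (by intro p hp
              rcases List.mem_cons.1 hp with rfl | hp
              · exact hi
              · exact hml p hp)
        simpa using this
      · have h1 : s * (a * (l.map Prod.snd).prod) =
            (s - ι (E s)) * (a * (l.map Prod.snd).prod)
              + (ι (E s) * a) * (l.map Prod.snd).prod := by noncomm_ring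
        rw [h1]
        refine add_mem ?_ ?_
        · have := prod_mem_altSpan (ι := ι) (E := E) (S := S) (m := m)
            (l := (i, s - ι (E s)) :: (j, a) :: l)
            (hl.cons (center_mem hS hs) (hE.map_center _) (by simpa using hij))
            (by intro p hp
                rcases List.mem_cons.1 hp with rfl | hp
                · exact hi
                · exact hm p hp)
          simpa using this
        · have := prod_mem_altSpan (ι := ι) (E := E) (S := S) (m := m)
            (l := (j, ι (E s) * a) :: l)
            (hl.replace_head (mul_mem (hS j _) ha.1) (by simp [hE.map_coe_mul, ha.2]))
            (by intro p hp
                rcases List.mem_cons.1 hp with rfl | hp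
                · exact hj
                · exact hml p hp)
          simpa using this
  | zero => simp
  | add x y _ _ hx hy => rw [mul_add]; exact add_mem hx hy
  | smul c x _ hx => rw [mul_smul_comm]; exact Submodule.smul_mem _ _ hx

/-- It avoids proving that the span is an algebra: stability under left multiplication by generators
extends to the whole adjoin, and is then applied to `1`. -/
lemma adjoin_le_altSpan {s : Set A}
    (hs : ∀ x ∈ s, ∀ w ∈ altSpan ι E S m, x * w ∈ altSpan ι E S m) {x : A}
    (hx : x ∈ Algebra.adjoin ℂ s) : x ∈ altSpan ι E S m := by
  have key : ∀ w ∈ altSpan ι E S m, x * w ∈ altSpan ι E S m := by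
    induction hx using Algebra.adjoin_induction with
    | mem x hx => exact hs x hx
    | algebraMap r =>
      intro w hw
      rw [← Algebra.smul_def]
      exact Submodule.smul_mem _ _ hw
    | add x y _ _ hx hy => intro w hw; rw [add_mul]; exact add_mem (hx w hw) (hy w hw)
    | mul x y _ _ hx hy => intro w hw; rw [mul_assoc]; exact hx _ (hy w hw)
  simpa using key _ (coe_mem_altSpan 1)

lemma FreeOver.map_words_eq_zero (hF : FreeOver E S) {l l' : List (ℕ × A)} {y : A}
    (hl : IsAlternating E S l) (hlm : ∀ p ∈ l, p.1 < m)
    (hl' : IsAlternating E S l') (hlm' : ∀ p ∈ l', p.1 < m) (hy : y ∈ S m) (hy0 : E y = 0) :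
    E ((l.map Prod.snd).prod * y * (l'.map Prod.snd).prod) = 0 := by
  have hc : IsAlternating E S ((m, y) :: l') :=
    hl'.cons hy hy0 fun p hp => (hlm' p (List.mem_of_mem_head? hp)).ne'
  have := hF.map_prod_eq_zero (l := l ++ (m, y) :: l')
    ⟨by
      intro p hp
      rcases List.mem_append.1 hp with hp | hp
      · exact hl.1 p hp
      · exact hc.1 p hp,
     by
      rw [List.isChain_append]
      refine ⟨hl.2, hc.2, ?_⟩
      intro p hp q hq
      simp only [List.head?_cons, Option.mem_def, Option.some.injEq] at hq
      subst hq
      exact (hlm p (List.mem_of_mem_getLast? hp)).ne⟩ (by simp)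
  simpa [mul_assoc] using this

/-- The middle word must be nonempty, since otherwise the two letters of index `m` would be
adjacent. The outer words may be empty. -/
lemma FreeOver.map_words_eq_zero₂ (hF : FreeOver E S) {l l₁ l' : List (ℕ × A)} {y y' : A}
    (hl : IsAlternating E S l) (hlm : ∀ p ∈ l, p.1 < m)
    (hl₁ : IsAlternating E S l₁) (hlm₁ : ∀ p ∈ l₁, p.1 < m) (hne : l₁ ≠ [])
    (hl' : IsAlternating E S l') (hlm' : ∀ p ∈ l', p.1 < m) (hy : y ∈ S m) (hy0 : E y = 0)
    (hy' : y' ∈ S m) (hy0' : E y' = 0) :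
    E ((l.map Prod.snd).prod * y * (l₁.map Prod.snd).prod * y' * (l'.map Prod.snd).prod) = 0 := by
  have hc : IsAlternating E S ((m, y') :: l') :=
    hl'.cons hy' hy0' fun p hp => (hlm' p (List.mem_of_mem_head? hp)).ne'
  have hc₁ : IsAlternating E S (l₁ ++ (m, y') :: l') :=
    ⟨by
      intro p hp
      rcases List.mem_append.1 hp with hp | hp
      · exact hl₁.1 p hp
      · exact hc.1 p hp,
     by
      rw [List.isChain_append]
      refine ⟨hl₁.2, hc.2, ?_⟩
      intro p hp q hq
      simp only [List.head?_cons, Option.mem_def, Option.some.injEq] at hq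
      subst hq
      exact (hlm₁ p (List.mem_of_mem_getLast? hp)).ne⟩
  have hc₂ : IsAlternating E S ((m, y) :: (l₁ ++ (m, y') :: l')) :=
    hc₁.cons hy hy0 fun p hp => by
      obtain ⟨q, l₂, rfl⟩ := List.exists_cons_of_ne_nil hne
      simp only [List.cons_append, List.head?_cons, Option.mem_def, Option.some.injEq] at hp
      subst hp
      exact (hlm₁ q (by simp)).ne'
  have := hF.map_prod_eq_zero (l := l ++ (m, y) :: (l₁ ++ (m, y') :: l'))
    ⟨by
      intro p hp
      rcases List.mem_append.1 hp with hp | hp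
      · exact hl.1 p hp
      · exact hc₂.1 p hp,
     by
      rw [List.isChain_append]
      refine ⟨hl.2, hc₂.2, ?_⟩
      intro p hp q hq
      simp only [List.head?_cons, Option.mem_def, Option.some.injEq] at hq
      subst hq
      exact (hlm p (List.mem_of_mem_getLast? hp)).ne⟩ (by simp)
  simpa [mul_assoc] using this

lemma FreeOver.map_altSpan_eq_zero (hE : IsCondExp ι E)
    (hF : FreeOver E S) {a c y : A} (ha : a ∈ altSpan ι E S m) (hc : c ∈ altSpan ι E S m)
    (hy : y ∈ S m) (hy0 : E y = 0) : E (a * y * c) = 0 := by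
  have hnil : IsAlternating E S [] := ⟨by simp, by simp⟩
  unfold altSpan at ha hc
  induction ha using Submodule.span_induction with
  | zero => simp
  | add x z _ _ hx hz => simp [add_mul, hx, hz]
  | smul r x _ hx => simp [hx]
  | mem a ha =>
    induction hc using Submodule.span_induction with
    | zero => simp
    | add x z _ _ hx hz => simp [mul_add, hx, hz]
    | smul r x _ hx => simp [hx]
    | mem c hc =>
      rcases ha with ⟨d, rfl⟩ | ⟨l, -, hl, hlm, rfl⟩ <;>
        rcases hc with ⟨d', rfl⟩ | ⟨l', -, hl', hlm', rfl⟩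
      · rw [hE.bimodule, hy0]; simp
      · rw [mul_assoc, hE.map_coe_mul]
        have := hF.map_words_eq_zero hnil (by simp) hl' hlm' hy hy0
        simp only [List.map_nil, List.prod_nil, one_mul] at this
        simp [this]
      · rw [hE.map_mul_coe]
        have := hF.map_words_eq_zero hl hlm hnil (by simp) hy hy0
        simp only [List.map_nil, List.prod_nil, mul_one] at this
        simp [this]
      · exact hF.map_words_eq_zero hl hlm hl' hlm' hy hy0

/-- By linearity in `b` there are two cases. For `b` in `D`, the element `y b y - η(b)` is a centred
letter of index `m`. For `b` a nonempty centred word, `E b = 0` and the full product is alternating,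
so both sides vanish. -/
lemma FreeOver.map_altSpan₂ (hE : IsCondExp ι E) (hS : ∀ i d, ι d ∈ S i)
    (hF : FreeOver E S) {a b c y : A} (ha : a ∈ altSpan ι E S m) (hb : b ∈ altSpan ι E S m)
    (hc : c ∈ altSpan ι E S m) (hy : y ∈ S m) (hy0 : E y = 0) (η : D →ₗ[ℂ] D)
    (hη : ∀ d, E (y * ι d * y) = η d) :
    E (a * y * b * y * c) = E (a * ι (η (E b)) * c) := by
  have hnil : IsAlternating E S [] := ⟨by simp, by simp⟩
  have hb' := hb
  unfold altSpan at hb'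
  induction hb' using Submodule.span_induction with
  | zero => simp
  | add x z h1 h2 hx hz => simp [add_mul, mul_add, hx h1, hz h2]
  | smul r x h1 hx => simp [hx h1]
  | mem b hb' =>
    rcases hb' with ⟨d, rfl⟩ | ⟨l₁, hne, hl₁, hlm₁, rfl⟩
    · rw [hE.map_coe]
      have hz : y * ι d * y - ι (η d) ∈ S m :=
        sub_mem (mul_mem (mul_mem hy (hS m d)) hy) (hS m _)
      have := FreeOver.map_altSpan_eq_zero hE hF ha hc hz (by simp [hη, hE.map_coe])
      rw [mul_sub, sub_mul, map_sub, sub_eq_zero] at this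
      rw [← this]
      simp only [mul_assoc]
    · rw [hF.map_prod_eq_zero hl₁ hne]
      simp only [map_zero, mul_zero, zero_mul]
      unfold altSpan at ha hc
      induction ha using Submodule.span_induction with
      | zero => simp
      | add x z _ _ hx hz => simp [add_mul, hx, hz]
      | smul r x _ hx => simp [hx]
      | mem a ha =>
        induction hc using Submodule.span_induction with
        | zero => simp
        | add x z _ _ hx hz => simp [mul_add, hx, hz]
        | smul r x _ hx => simp [hx]
        | mem c hc =>
          rcases ha with ⟨d, rfl⟩ | ⟨l, -, hl, hlm, rfl⟩ <;>
            rcases hc with ⟨d', rfl⟩ | ⟨l', -, hl', hlm', rfl⟩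
          · have := hF.map_words_eq_zero₂ hnil (by simp) hl₁ hlm₁ hne hnil (by simp) hy hy0 hy hy0
            simp only [List.map_nil, List.prod_nil, one_mul, mul_one] at this
            rw [hE.map_mul_coe]
            simp only [mul_assoc, hE.map_coe_mul]
            simp only [mul_assoc] at this
            simp [this]
          · have := hF.map_words_eq_zero₂ hnil (by simp) hl₁ hlm₁ hne hl' hlm' hy hy0 hy hy0
            simp only [List.map_nil, List.prod_nil, one_mul] at this
            simp only [mul_assoc, hE.map_coe_mul]
            simp only [mul_assoc] at this
            simp [this]
          · have := hF.map_words_eq_zero₂ hl hlm hl₁ hlm₁ hne hnil (by simp) hy hy0 hy hy0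
            simp only [List.map_nil, List.prod_nil, mul_one] at this
            rw [hE.map_mul_coe, this, zero_mul]
          · exact hF.map_words_eq_zero₂ hl hlm hl₁ hlm₁ hne hl' hlm' hy hy0 hy hy0

end Freeness

/-! ### Moments of Brownian increments against the past. -/

section Increments

variable {D A : Type*} [CStarAlgebra D] [PartialOrder D] [StarOrderedRing D]
  [CStarAlgebra A] [PartialOrder A] [StarOrderedRing A]
  {ι : D →⋆ₐ[ℂ] A} {E : A →ₚ[ℂ] D} {σ : D →CP D} {X : ℝ → A}

lemma IsSemicircular.map_eq_zero {η : D → D} {S : A} (h : IsSemicircular ι E η S) : E S = 0 := by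
  simpa [word] using h []

/-- Two points have a single non-crossing pairing. Of the semicircular law, only the moments of
first and second order enter the Itô rules. -/
lemma IsSemicircular.map_sq {η : D → D} {S : A} (h : IsSemicircular ι E η S) (d : D) :
    E (S * ι d * S) = η d := by
  have h1 : E (S * ι d * S) = pairingValue η (.node () .nil .nil) [1, d, 1] := by
    have h2 : BinaryTree.treesOfNumNodesEq 1 = {.node () .nil .nil} := by
      simp only [BinaryTree.treesOfNumNodesEq_succ, Finset.Nat.antidiagonal_zero,
        Finset.singleton_biUnion, BinaryTree.treesOfNumNodesEq_zero, BinaryTree.pairwiseNode,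
        Finset.singleton_product_singleton, Finset.map_singleton]
      rfl
    simpa [word, h2] using h [d]
  simpa [pairingValue] using h1

/-- The times `F` in increasing order, followed by the constant `t`. -/
lemma exists_monotone_enum (F : Finset ℝ) (t : ℝ) (hF : ∀ u ∈ F, u ≤ t) :
    ∃ (τ : ℕ → ℝ) (m : ℕ), Monotone τ ∧ (∀ k < m, τ k ∈ F) ∧ (∀ k, m ≤ k → τ k = t) ∧
      ∀ u ∈ F, ∃ k < m, τ k = u := by
  refine ⟨fun k => if h : k < F.card then F.orderEmbOfFin rfl ⟨k, h⟩ else t, F.card, ?_, ?_, ?_, ?_⟩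
  · intro k l hkl
    by_cases hl : l < F.card
    · have hk : k < F.card := by omega
      simp only [hk, hl, dif_pos]
      exact (F.orderEmbOfFin rfl).monotone hkl
    · by_cases hk : k < F.card
      · simp only [hk, hl, dif_pos, dif_neg, not_false_iff]
        exact hF _ (F.orderEmbOfFin_mem rfl _)
      · simp [hk, hl]
  · intro k hk
    simp only [hk, dif_pos]
    exact F.orderEmbOfFin_mem rfl _
  · intro k hk
    simp [not_lt.2 hk]
  · intro u hu
    have : u ∈ Set.range (F.orderEmbOfFin rfl) := by
      rw [Finset.range_orderEmbOfFin]; exact hu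
    obtain ⟨⟨k, hk⟩, rfl⟩ := this
    exact ⟨k, hk, by simp [hk]⟩

lemma exists_finset_mem_adjoin {s : ℝ} {a : A}
    (ha : a ∈ StarAlgebra.adjoin ℂ (range ι ∪ X '' Icc 0 s)) :
    ∃ F : Finset ℝ, ↑F ⊆ Icc 0 s ∧ a ∈ StarAlgebra.adjoin ℂ (range ι ∪ X '' F) := by
  have hmono : ∀ {F G : Finset ℝ}, F ⊆ G → StarAlgebra.adjoin ℂ (range ι ∪ X '' F) ≤
      StarAlgebra.adjoin ℂ (range ι ∪ X '' G) := fun h =>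
    StarAlgebra.adjoin_mono (union_subset_union_right _ (image_mono (by exact_mod_cast h)))
  induction ha using StarAlgebra.adjoin_induction with
  | mem x hx =>
    rcases hx with hx | ⟨u, hu, rfl⟩
    · exact ⟨∅, by simp, StarAlgebra.subset_adjoin _ _ (Or.inl hx)⟩
    · exact ⟨{u}, by simpa using hu, StarAlgebra.subset_adjoin _ _ (Or.inr ⟨u, by simp, rfl⟩)⟩
  | algebraMap r => exact ⟨∅, by simp, algebraMap_mem _ r⟩
  | add x y _ _ hx hy =>
    classical
    obtain ⟨F, hF, hx⟩ := hx
    obtain ⟨G, hG, hy⟩ := hy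
    exact ⟨F ∪ G, by simp [hF, hG], add_mem (hmono Finset.subset_union_left hx)
      (hmono Finset.subset_union_right hy)⟩
  | mul x y _ _ hx hy =>
    classical
    obtain ⟨F, hF, hx⟩ := hx
    obtain ⟨G, hG, hy⟩ := hy
    exact ⟨F ∪ G, by simp [hF, hG], mul_mem (hmono Finset.subset_union_left hx)
      (hmono Finset.subset_union_right hy)⟩
  | star x _ hx =>
    obtain ⟨F, hF, hx⟩ := hx
    exact ⟨F, hF, star_mem hx⟩

/-- Finitely many elements of the past of `s` lie in the span of the alternating words in
increments of `X` before `s`. -/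
lemma IsFreeBrownianMotion.exists_altSpan (hE : IsCondExp ι E) (hX : IsFreeBrownianMotion ι E σ X)
    {s t : ℝ} (hs : 0 ≤ s) (hst : s ≤ t) {F : Finset ℝ} (hF : ↑F ⊆ Icc 0 s) :
    ∃ (S : ℕ → StarSubalgebra ℂ A) (m : ℕ), FreeOver E S ∧ (∀ i d, ι d ∈ S i) ∧ X t - X s ∈ S m ∧
      ∀ a ∈ StarAlgebra.adjoin ℂ (range ι ∪ X '' F), a ∈ altSpan ι E S m := by
  classical
  -- Adding `0` lets every `X u` telescope from `X 0 = 0`. Adding `s` makes `s` the largest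
  -- enumerated time, so the next increment is exactly `X t - X s`.
  obtain ⟨τ, m, hτ, hτF, hτt, hFτ⟩ := exists_monotone_enum (insert 0 (insert s F)) t (by
    intro u hu
    simp only [Finset.mem_insert] at hu
    rcases hu with rfl | rfl | hu
    · exact hs.trans hst
    · exact hst
    · exact (hF hu).2.trans hst)
  have hbd : ∀ k < m, 0 ≤ τ k ∧ τ k ≤ s := by
    intro k hk
    have := hτF k hk
    simp only [Finset.mem_insert] at this
    rcases this with h | h | h
    · rw [h]; exact ⟨le_rfl, hs⟩
    · rw [h]; exact ⟨hs, le_rfl⟩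
    · exact hF h
  obtain ⟨k0, hk0, hk00⟩ := hFτ 0 (by simp)
  obtain ⟨ks, hks, hkss⟩ := hFτ s (by simp)
  have hm : 0 < m := by omega
  have h0 : τ 0 = 0 := le_antisymm (hk00 ▸ hτ (Nat.zero_le _)) (hbd 0 hm).1
  have hlast : τ (m - 1) = s := le_antisymm (hbd (m - 1) (by omega)).2 (hkss ▸ hτ (by omega))
  set S : ℕ → StarSubalgebra ℂ A := fun k =>
    StarAlgebra.adjoin ℂ (range ι ∪ {X (τ (k + 1)) - X (τ k)}) with hSdef
  have hSι : ∀ i d, ι d ∈ S i := fun i d => StarAlgebra.subset_adjoin _ _ (Or.inl ⟨d, rfl⟩)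
  have hSX : ∀ i, X (τ (i + 1)) - X (τ i) ∈ S i := fun i =>
    StarAlgebra.subset_adjoin _ _ (Or.inr rfl)
  -- The times of index `0, …, m - 1` end at `s`, so the past increments have index `< m - 1` and
  -- the increment from `s` to `t` has index `m - 1`.
  refine ⟨S, m - 1, hX.free τ hτ (by rw [h0]), hSι, ?_, ?_⟩
  · have := hSX (m - 1)
    rwa [hlast, hτt (m - 1 + 1) (by omega)] at this
  · intro a ha
    have hXmul : ∀ k, k ≤ m - 1 → ∀ w ∈ altSpan ι E S (m - 1),
        X (τ k) * w ∈ altSpan ι E S (m - 1) := by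
      intro k
      induction k with
      | zero => intro _ w _; rw [h0, hX.zero, zero_mul]; exact zero_mem _
      | succ k ih =>
        intro hk w hw
        have h1 : X (τ (k + 1)) * w = (X (τ (k + 1)) - X (τ k)) * w + X (τ k) * w := by
          noncomm_ring
        rw [h1]
        exact add_mem (mul_mem_altSpan hE hSι (by omega) (hSX k) hw) (ih (by omega) w hw)
    have hstar : star (range ι ∪ X '' (F : Set ℝ)) ⊆ range ι ∪ X '' (F : Set ℝ) := by
      intro x hx
      rw [Set.mem_star] at hx
      rcases hx with ⟨d, hd⟩ | ⟨u, hu, hux⟩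
      · exact Or.inl ⟨star d, by rw [map_star, hd, star_star]⟩
      · refine Or.inr ⟨u, hu, ?_⟩
        have := (hX.selfAdjoint u (hF hu).1).star_eq
        rw [hux, star_star] at this
        rw [hux]
        exact this.symm
    rw [← StarSubalgebra.mem_toSubalgebra, StarAlgebra.adjoin_toSubalgebra,
      union_eq_self_of_subset_right hstar] at ha
    have hD : ∀ d : D, ∀ w ∈ altSpan ι E S (m - 1), ι d * w ∈ altSpan ι E S (m - 1) := by
      intro d w hw
      -- With no past increment there is no algebra of index `< m - 1` in which to place `ι d`. The
      -- span is then just `D`.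
      rcases Nat.eq_zero_or_pos (m - 1) with h | h
      · unfold altSpan at hw
        induction hw using Submodule.span_induction with
        | zero => simp
        | add x y _ _ hx hy => rw [mul_add]; exact add_mem hx hy
        | smul c x _ hx => rw [mul_smul_comm]; exact Submodule.smul_mem _ _ hx
        | mem x hx =>
          rcases hx with ⟨d', rfl⟩ | ⟨l, hne, -, hl, rfl⟩
          · rw [← map_mul]; exact coe_mem_altSpan _
          · obtain ⟨p, l, rfl⟩ := List.exists_cons_of_ne_nil hne
            have := hl p (by simp)
            omega
      · exact mul_mem_altSpan hE hSι h (hSι 0 d) hw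
    refine adjoin_le_altSpan ?_ ha
    rintro x (⟨d, rfl⟩ | ⟨u, hu, rfl⟩) w hw
    · exact hD d w hw
    · obtain ⟨k, hk, rfl⟩ := hFτ u (by simp [Finset.mem_coe.1 hu])
      exact hXmul k (by omega) w hw

lemma map_closure_induction {a : A} {S : StarSubalgebra ℂ A} {f g : A → D} (hf : Continuous f)
    (hg : Continuous g) (h : ∀ x ∈ S, f x = g x) (ha : a ∈ S.topologicalClosure) : f a = g a :=
  closure_minimal (t := {x | f x = g x}) (fun x hx => h x hx) (isClosed_eq hf hg) ha

lemma continuous_cp (σ : D →CP D) : Continuous σ := map_continuous σ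

/-- By continuity `a` and `c` may be taken in the dense `*`-algebra generated by the past. They then
involve finitely many times, and one common partition puts them both in the same span of alternating
words. -/
lemma IsFreeBrownianMotion.map_increment (hE : IsCondExp ι E) (hX : IsFreeBrownianMotion ι E σ X)
    {s t : ℝ} (hs : 0 ≤ s) (hst : s ≤ t) {a c : A} (ha : a ∈ filtration ι X s)
    (hc : c ∈ filtration ι X s) : E (a * (X t - X s) * c) = 0 := by
  classical
  have hEc : Continuous E := map_continuous E
  refine map_closure_induction (f := fun a => E (a * (X t - X s) * c)) (g := fun _ => 0)
    (by fun_prop) (by fun_prop) (fun a ha => ?_) ha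
  refine map_closure_induction (f := fun c => E (a * (X t - X s) * c)) (g := fun _ => 0)
    (by fun_prop) (by fun_prop) (fun c hc => ?_) hc
  obtain ⟨F, hF, haF⟩ := exists_finset_mem_adjoin ha
  obtain ⟨G, hG, hcG⟩ := exists_finset_mem_adjoin hc
  obtain ⟨S, m, hfree, hSι, hXS, hmem⟩ :=
    hX.exists_altSpan hE hs hst (F := F ∪ G) (by simp [hF, hG])
  have hle : ∀ {F' : Finset ℝ}, F' ⊆ F ∪ G → ∀ a ∈ StarAlgebra.adjoin ℂ (range ι ∪ X '' F'),
      a ∈ altSpan ι E S m := fun h a ha => hmem a (StarAlgebra.adjoin_mono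
        (union_subset_union_right _ (image_mono (by exact_mod_cast h))) ha)
  exact FreeOver.map_altSpan_eq_zero hE hfree (hle Finset.subset_union_left a haF)
    (hle Finset.subset_union_right c hcG) hXS (hX.semicircular s t hs hst).map_eq_zero

lemma IsFreeBrownianMotion.map_increment_sq (hE : IsCondExp ι E)
    (hX : IsFreeBrownianMotion ι E σ X)
    {s t : ℝ} (hs : 0 ≤ s) (hst : s ≤ t) {a b c : A} (ha : a ∈ filtration ι X s)
    (hb : b ∈ filtration ι X s) (hc : c ∈ filtration ι X s) :
    E (a * (X t - X s) * b * (X t - X s) * c) =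
      ((t - s : ℝ) : ℂ) • E (a * ι (σ (E b)) * c) := by
  classical
  have hEc : Continuous E := map_continuous E
  have hσ : Continuous σ := continuous_cp σ
  have hι : Continuous ι := map_continuous ι
  refine map_closure_induction (f := fun a => E (a * (X t - X s) * b * (X t - X s) * c))
    (g := fun a => ((t - s : ℝ) : ℂ) • E (a * ι (σ (E b)) * c))
    (by fun_prop) (by fun_prop) (fun a ha => ?_) ha
  refine map_closure_induction (f := fun b => E (a * (X t - X s) * b * (X t - X s) * c))
    (g := fun b => ((t - s : ℝ) : ℂ) • E (a * ι (σ (E b)) * c))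
    (by fun_prop) (by fun_prop) (fun b hb => ?_) hb
  refine map_closure_induction (f := fun c => E (a * (X t - X s) * b * (X t - X s) * c))
    (g := fun c => ((t - s : ℝ) : ℂ) • E (a * ι (σ (E b)) * c))
    (by fun_prop) (by fun_prop) (fun c hc => ?_) hc
  obtain ⟨F, hF, haF⟩ := exists_finset_mem_adjoin ha
  obtain ⟨G, hG, hbG⟩ := exists_finset_mem_adjoin hb
  obtain ⟨H, hH, hcH⟩ := exists_finset_mem_adjoin hc
  obtain ⟨S, m, hfree, hSι, hXS, hmem⟩ :=
    hX.exists_altSpan hE hs hst (F := F ∪ (G ∪ H)) (by simp [hF, hG, hH])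
  have hle : ∀ {F' : Finset ℝ}, F' ⊆ F ∪ (G ∪ H) →
      ∀ a ∈ StarAlgebra.adjoin ℂ (range ι ∪ X '' F'), a ∈ altSpan ι E S m :=
    fun h a ha => hmem a (StarAlgebra.adjoin_mono
        (union_subset_union_right _ (image_mono (by exact_mod_cast h))) ha)
  have h0 := (hX.semicircular s t hs hst).map_eq_zero
  have h2 := (hX.semicircular s t hs hst).map_sq
  have := FreeOver.map_altSpan₂ hE hSι hfree (hle Finset.subset_union_left a haF)
    (hle (Finset.subset_union_left.trans Finset.subset_union_right) b hbG)
    (hle (Finset.subset_union_right.trans Finset.subset_union_right) c hcH) hXS h0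
    (((t - s : ℝ) : ℂ) • (σ : D →ₗ[ℂ] D)) (by intro d; rw [h2]; simp)
  rw [this]
  simp

end Increments

/-! ### First and second moments of Riemann sums. -/

section Integrals

variable {D A : Type*} [CStarAlgebra D] [PartialOrder D] [StarOrderedRing D]
  [CStarAlgebra A] [PartialOrder A] [StarOrderedRing A]
  {ι : D →⋆ₐ[ℂ] A} {E : A →ₚ[ℂ] D} {σ : D →CP D} {X : ℝ → A}

lemma filtration_mono {s t : ℝ} (hst : s ≤ t) : filtration ι X s ≤ filtration ι X t :=
  StarSubalgebra.topologicalClosure_mono <| StarAlgebra.adjoin_mono <|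
    union_subset_union_right _ (image_mono (Icc_subset_Icc_right hst))

lemma coe_mem_filtration (t : ℝ) (d : D) : ι d ∈ filtration ι X t :=
  StarSubalgebra.le_topologicalClosure _ (StarAlgebra.subset_adjoin _ _ (Or.inl ⟨d, rfl⟩))

lemma path_mem_filtration {s t : ℝ} (hs : 0 ≤ s) (hst : s ≤ t) : X s ∈ filtration ι X t :=
  StarSubalgebra.le_topologicalClosure _
    (StarAlgebra.subset_adjoin _ _ (Or.inr ⟨s, ⟨hs, hst⟩, rfl⟩))

/-- The Riemann sum of `∫ F (dX) G` over the partition `τ₀ ≤ ⋯ ≤ τ_n`. -/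
def riemannSum (X F G : ℝ → A) (τ : ℕ → ℝ) (n : ℕ) : A :=
  ∑ k ∈ Finset.range n, F (τ k) * (X (τ (k + 1)) - X (τ k)) * G (τ k)

variable {t : ℝ} {F G F' G' : ℝ → A} {τ : ℕ → ℝ} {n : ℕ} {a b c : A}

lemma IsFreeBrownianMotion.map_riemannSum (hE : IsCondExp ι E)
    (hX : IsFreeBrownianMotion ι E σ X) (ht : 0 ≤ t) (hτ : Monotone τ) (hτ0 : τ 0 = t)
    (hF : ∀ u, t ≤ u → F u ∈ filtration ι X u) (hG : ∀ u, t ≤ u → G u ∈ filtration ι X u)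
    (ha : a ∈ filtration ι X t) (hc : c ∈ filtration ι X t) :
    E (a * riemannSum X F G τ n * c) = 0 := by
  have hle : ∀ k, t ≤ τ k := fun k => hτ0 ▸ hτ (Nat.zero_le k)
  rw [riemannSum, Finset.mul_sum, Finset.sum_mul, map_sum]
  refine Finset.sum_eq_zero fun k _ => ?_
  have := hX.map_increment hE (ht.trans (hle k)) (hτ (Nat.le_succ k))
    (mul_mem (filtration_mono (hle k) ha) (hF _ (hle k)))
    (mul_mem (hG _ (hle k)) (filtration_mono (hle k) hc))
  simpa [mul_assoc] using this

/-- In an off-diagonal term the later of the two increments is centred given everything else, which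
lies in its past. The diagonal terms are the second-order Itô rule. -/
lemma IsFreeBrownianMotion.map_riemannSum₂ (hE : IsCondExp ι E)
    (hX : IsFreeBrownianMotion ι E σ X) (ht : 0 ≤ t) (hτ : Monotone τ) (hτ0 : τ 0 = t)
    (hF : ∀ u, t ≤ u → F u ∈ filtration ι X u) (hG : ∀ u, t ≤ u → G u ∈ filtration ι X u)
    (hF' : ∀ u, t ≤ u → F' u ∈ filtration ι X u) (hG' : ∀ u, t ≤ u → G' u ∈ filtration ι X u)
    (ha : a ∈ filtration ι X t) (hb : b ∈ filtration ι X t) (hc : c ∈ filtration ι X t) :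
    E (a * riemannSum X F G τ n * b * riemannSum X F' G' τ n * c) =
      ∑ k ∈ Finset.range n, (τ (k + 1) - τ k) •
        E (a * F (τ k) * ι (σ (E (G (τ k) * b * F' (τ k)))) * G' (τ k) * c) := by
  have hle : ∀ k, t ≤ τ k := fun k => hτ0 ▸ hτ (Nat.zero_le k)
  have hd : ∀ k l, k < l → X (τ (k + 1)) - X (τ k) ∈ filtration ι X (τ l) := fun k l hkl =>
    sub_mem (path_mem_filtration (ht.trans (hle _)) (hτ hkl))
      (path_mem_filtration (ht.trans (hle _)) (hτ hkl.le))
  have hm : ∀ {H : ℝ → A}, (∀ u, t ≤ u → H u ∈ filtration ι X u) → ∀ k l, k ≤ l →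
      H (τ k) ∈ filtration ι X (τ l) := fun hH k l hkl => filtration_mono (hτ hkl) (hH _ (hle k))
  have hexp : a * riemannSum X F G τ n * b * riemannSum X F' G' τ n * c =
      ∑ k ∈ Finset.range n, ∑ l ∈ Finset.range n,
        a * (F (τ k) * (X (τ (k + 1)) - X (τ k)) * G (τ k)) * b *
          (F' (τ l) * (X (τ (l + 1)) - X (τ l)) * G' (τ l)) * c := by
    simp only [riemannSum, Finset.mul_sum, Finset.sum_mul]
    rw [Finset.sum_comm]
  rw [hexp, map_sum]
  refine Finset.sum_congr rfl fun k hk => ?_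
  rw [map_sum, Finset.sum_eq_single k]
  · have := hX.map_increment_sq hE (ht.trans (hle k)) (hτ (Nat.le_succ k))
      (mul_mem (filtration_mono (hle k) ha) (hF _ (hle k)))
      (mul_mem (mul_mem (hG _ (hle k)) (filtration_mono (hle k) hb)) (hF' _ (hle k)))
      (mul_mem (hG' _ (hle k)) (filtration_mono (hle k) hc))
    rw [Complex.coe_smul] at this
    simpa only [mul_assoc] using this
  · intro l _ hlk
    rcases lt_or_gt_of_ne hlk with h | h
    · have := hX.map_increment hE (ht.trans (hle k)) (hτ (Nat.le_succ k))
        (mul_mem (filtration_mono (hle k) ha) (hF _ (hle k)))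
        (mul_mem (mul_mem (mul_mem (hG _ (hle k)) (filtration_mono (hle k) hb))
          (mul_mem (mul_mem (hm hF' l k h.le) (hd l k h)) (hm hG' l k h.le)))
          (filtration_mono (hle k) hc))
      simpa only [mul_assoc] using this
    · have := hX.map_increment hE (ht.trans (hle l)) (hτ (Nat.le_succ l))
        (mul_mem (mul_mem (mul_mem (filtration_mono (hle l) ha)
          (mul_mem (mul_mem (hm hF k l h.le) (hd k l h)) (hm hG k l h.le)))
          (filtration_mono (hle l) hb)) (hF' _ (hle l)))
        (mul_mem (hG' _ (hle l)) (filtration_mono (hle l) hc))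
      simpa only [mul_assoc] using this
  · exact fun h => absurd hk h

lemma IsFreeBrownianMotion.norm_map_riemannSum₂_sub_le (hE : IsCondExp ι E)
    (hX : IsFreeBrownianMotion ι E σ X) (ht : 0 ≤ t) (hτ : Monotone τ) (hτ0 : τ 0 = t)
    {s : ℝ} (hτn : τ n = s)
    (hF : ∀ u, t ≤ u → F u ∈ filtration ι X u) (hG : ∀ u, t ≤ u → G u ∈ filtration ι X u)
    (hF' : ∀ u, t ≤ u → F' u ∈ filtration ι X u) (hG' : ∀ u, t ≤ u → G' u ∈ filtration ι X u)
    (ha : a ∈ filtration ι X t) (hb : b ∈ filtration ι X t) (hc : c ∈ filtration ι X t)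
    {d : D} {ε : ℝ}
    (hd : ∀ u ∈ Icc t s, ‖E (a * F u * ι (σ (E (G u * b * F' u))) * G' u * c) - d‖ ≤ ε) :
    ‖E (a * riemannSum X F G τ n * b * riemannSum X F' G' τ n * c) - (s - t) • d‖
      ≤ ε * (s - t) := by
  have htel : ∑ k ∈ Finset.range n, (τ (k + 1) - τ k) = s - t := by
    rw [Finset.sum_range_sub, hτ0, hτn]
  rw [hX.map_riemannSum₂ hE ht hτ hτ0 hF hG hF' hG' ha hb hc, ← htel, Finset.sum_smul,
    ← Finset.sum_sub_distrib, Finset.mul_sum]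
  refine norm_sum_le_of_le _ fun k hk => ?_
  have hk : k < n := Finset.mem_range.1 hk
  have h0 : 0 ≤ τ (k + 1) - τ k := sub_nonneg.2 (hτ (Nat.le_succ k))
  rw [← smul_sub, norm_smul, Real.norm_of_nonneg h0, mul_comm]
  exact mul_le_mul_of_nonneg_right
    (hd _ ⟨hτ0 ▸ hτ (Nat.zero_le k), hτn ▸ hτ hk.le⟩) h0

end Integrals

/-! ### Right slopes at a fixed time. -/

section Slope

variable {V : Type*} [NormedAddCommGroup V] [NormedSpace ℝ V]

/-- `f s = (s - t) d + o(s - t)` as `s` decreases to `t`. -/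
def IsSlope (t : ℝ) (f : ℝ → V) (d : V) : Prop :=
  (fun s => f s - (s - t) • d) =o[𝓝[>] t] fun s => s - t

variable {t : ℝ} {f g : ℝ → V} {d e : V}

lemma IsSlope.add (hf : IsSlope t f d) (hg : IsSlope t g e) :
    IsSlope t (fun s => f s + g s) (d + e) := by
  unfold IsSlope at *
  refine (Asymptotics.IsLittleO.add hf hg).congr_left fun s => ?_
  dsimp only
  module

lemma IsSlope.sub (hf : IsSlope t f d) (hg : IsSlope t g e) :
    IsSlope t (fun s => f s - g s) (d - e) := by
  unfold IsSlope at *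
  refine (Asymptotics.IsLittleO.sub hf hg).congr_left fun s => ?_
  dsimp only
  module

lemma IsSlope.map {W : Type*} [NormedAddCommGroup W] [NormedSpace ℝ W] (hf : IsSlope t f d)
    (L : V →L[ℝ] W) : IsSlope t (fun s => L (f s)) (L d) := by
  unfold IsSlope at *
  refine Asymptotics.IsBigO.trans_isLittleO ?_ hf
  have := L.isBigO_comp (fun s => f s - (s - t) • d) (𝓝[>] t)
  simpa using this

lemma IsSlope.const_smul [NormedSpace ℂ V] [IsScalarTower ℝ ℂ V] (hf : IsSlope t f d) (r : ℂ) :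
    IsSlope t (fun s => r • f s) (r • d) := by
  unfold IsSlope at *
  refine (Asymptotics.IsLittleO.const_smul_left hf r).congr_left fun s => ?_
  rw [Pi.smul_apply, smul_sub, smul_comm]

lemma IsSlope.sum {I : Type*} {S : Finset I} {f : I → ℝ → V} {d : I → V}
    (h : ∀ i ∈ S, IsSlope t (f i) (d i)) :
    IsSlope t (fun s => ∑ i ∈ S, f i s) (∑ i ∈ S, d i) := by
  unfold IsSlope at *
  refine (Asymptotics.IsLittleO.sum h).congr_left fun s => ?_
  rw [Finset.sum_apply, Finset.smul_sum, Finset.sum_sub_distrib]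

lemma IsSlope.congr_littleO (hf : IsSlope t f d) (h : (fun s => g s - f s) =o[𝓝[>] t] fun s => s - t) :
    IsSlope t g d := by
  unfold IsSlope at *
  refine (Asymptotics.IsLittleO.add hf h).congr_left fun s => ?_
  abel

lemma isSlope_zero_iff : IsSlope t f 0 ↔ f =o[𝓝[>] t] fun s => s - t := by
  simp [IsSlope]

lemma IsSlope.congr' (hf : IsSlope t f d) (h : f =ᶠ[𝓝[>] t] g) : IsSlope t g d := by
  unfold IsSlope at *
  exact hf.congr' (h.mono fun s hs => by simp only [hs]) EventuallyEq.rfl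

lemma IsSlope.isBigO (hf : IsSlope t f d) : f =O[𝓝[>] t] fun s => s - t := by
  have h1 : (fun s => (s - t) • d) =O[𝓝[>] t] fun s => s - t :=
    Asymptotics.IsBigO.of_bound ‖d‖ (Eventually.of_forall fun s => by
      rw [norm_smul, mul_comm])
  have h2 : (fun s => f s - (s - t) • d) =O[𝓝[>] t] fun s => s - t := Asymptotics.IsLittleO.isBigO hf
  exact (Asymptotics.IsBigO.add h2 h1).congr_left fun s => by simp

end Slope

/-! ### The Itô table for the martingale part. -/

section Asymptotics

variable {D A : Type*} [CStarAlgebra D] [PartialOrder D] [StarOrderedRing D]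
  [CStarAlgebra A] [PartialOrder A] [StarOrderedRing A]
  {ι : D →⋆ₐ[ℂ] A} {E : A →ₚ[ℂ] D} {σ : D →CP D} {X U : ℝ → A} {t : ℝ} {J : ℝ → A}
  {a b c : A}

/-- The Riemann sums of `∫ₜˢ (dX) U`. -/
def riemannSums (X U : ℝ → A) (t s : ℝ) : Set A :=
  {x | ∃ (n : ℕ) (τ : ℕ → ℝ), Monotone τ ∧ τ 0 = t ∧ τ n = s ∧
    x = riemannSum X (fun _ => 1) U τ n}

lemma IsFreeBrownianMotion.map_integral (hE : IsCondExp ι E) (hX : IsFreeBrownianMotion ι E σ X)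
    (ht : 0 ≤ t) (hU : ∀ u, t ≤ u → U u ∈ filtration ι X u) {s : ℝ} {x : A}
    (hx : x ∈ closure (riemannSums X U t s))
    (ha : a ∈ filtration ι X t) (hc : c ∈ filtration ι X t) : E (a * x * c) = 0 := by
  have hEc : Continuous E := map_continuous E
  refine closure_minimal (t := {x | E (a * x * c) = 0}) ?_
    (isClosed_eq (by fun_prop) continuous_const) hx
  rintro _ ⟨n, τ, hτ, hτ0, -, rfl⟩
  exact hX.map_riemannSum hE ht hτ hτ0 (fun _ _ => one_mem _) hU ha hc

lemma IsFreeBrownianMotion.star_riemannSum (hX : IsFreeBrownianMotion ι E σ X) (F G : ℝ → A)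
    {τ : ℕ → ℝ} (hτ : ∀ k, 0 ≤ τ k) (n : ℕ) :
    star (riemannSum X F G τ n) =
      riemannSum X (fun s => star (G s)) (fun s => star (F s)) τ n := by
  simp only [riemannSum, star_sum, star_mul, star_sub, (hX.selfAdjoint _ (hτ _)).star_eq,
    mul_assoc]

/-- For `s` close to `t`, the deviation from `(s - t) d` is at most `ε (s - t)` for every Riemann
sum, whatever its mesh. This is a closed condition, so it holds on the closure. The maps `f` and `g`
stand for the identity or the adjoint, so that all four products of an integral and its adjoint are
covered. -/
lemma IsFreeBrownianMotion.isSlope_integral₂ (hE : IsCondExp ι E)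
    (hX : IsFreeBrownianMotion ι E σ X) (ht : 0 ≤ t) {F G F' G' : ℝ → A}
    (hF : ∀ u, t ≤ u → F u ∈ filtration ι X u) (hG : ∀ u, t ≤ u → G u ∈ filtration ι X u)
    (hF' : ∀ u, t ≤ u → F' u ∈ filtration ι X u) (hG' : ∀ u, t ≤ u → G' u ∈ filtration ι X u)
    (cF : ContinuousWithinAt F (Ici t) t) (cG : ContinuousWithinAt G (Ici t) t)
    (cF' : ContinuousWithinAt F' (Ici t) t) (cG' : ContinuousWithinAt G' (Ici t) t)
    (ha : a ∈ filtration ι X t) (hb : b ∈ filtration ι X t) (hc : c ∈ filtration ι X t)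
    (hJ : ∀ s, t < s → J s ∈ closure (riemannSums X U t s))
    {f g : A → A} (hf : Continuous f) (hg : Continuous g)
    (hfs : ∀ (τ : ℕ → ℝ) (n : ℕ), (∀ k, 0 ≤ τ k) →
      f (riemannSum X (fun _ => 1) U τ n) = riemannSum X F G τ n)
    (hgs : ∀ (τ : ℕ → ℝ) (n : ℕ), (∀ k, 0 ≤ τ k) →
      g (riemannSum X (fun _ => 1) U τ n) = riemannSum X F' G' τ n) :
    IsSlope t (fun s => E (a * f (J s) * b * g (J s) * c))
      (E (a * F t * ι (σ (E (G t * b * F' t))) * G' t * c)) := by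
  have hEc : Continuous E := map_continuous E
  have hσ : Continuous σ := continuous_cp σ
  have hι : Continuous ι := map_continuous ι
  set d := E (a * F t * ι (σ (E (G t * b * F' t))) * G' t * c) with hd
  have hcont : ContinuousWithinAt
      (fun u => E (a * F u * ι (σ (E (G u * b * F' u))) * G' u * c)) (Ici t) t := by
    refine hEc.continuousAt.comp_continuousWithinAt ?_
    refine ContinuousWithinAt.mul (ContinuousWithinAt.mul (ContinuousWithinAt.mul
      (continuousWithinAt_const.mul cF) ?_) cG') continuousWithinAt_const
    exact (hι.comp (hσ.comp hEc)).continuousAt.comp_continuousWithinAt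
      ((cG.mul continuousWithinAt_const).mul cF')
  unfold IsSlope
  rw [Asymptotics.isLittleO_iff]
  intro ε hε
  have h1 := (Metric.continuousWithinAt_iff.1 hcont) ε hε
  obtain ⟨δ, hδ, h1⟩ := h1
  have h2 : Ioo t (t + δ) ∈ 𝓝[>] t := Ioo_mem_nhdsGT (by linarith)
  filter_upwards [h2] with s hs
  rw [Real.norm_of_nonneg (sub_nonneg.2 hs.1.le)]
  refine closure_minimal
    (t := {x | ‖E (a * f x * b * g x * c) - (s - t) • d‖ ≤ ε * (s - t)}) ?_
    (isClosed_le (by fun_prop) continuous_const) (hJ s hs.1)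
  rintro _ ⟨n, τ, hτ, hτ0, hτn, rfl⟩
  have hτp : ∀ k, 0 ≤ τ k := fun k => ht.trans (hτ0 ▸ hτ (Nat.zero_le k))
  rw [mem_ofPred_eq, hfs τ n hτp, hgs τ n hτp]
  refine hX.norm_map_riemannSum₂_sub_le hE ht hτ hτ0 hτn hF hG hF' hG' ha hb hc ?_
  intro u hu
  have := h1 (x := u) hu.1 (by
    rw [Real.dist_eq, abs_of_nonneg (by linarith [hu.1])]; linarith [hu.2, hs.2])
  rw [dist_eq_norm] at this
  exact this.le

/-- The increment `∫ₜˢ (dX) U` of the martingale part of an evolution. -/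
def martingaleIncrement (ι : D →⋆ₐ[ℂ] A) (σ : D →CP D) (U : ℝ → A) (t s : ℝ) : A :=
  (-Complex.I) • (U s - U t + (1 / 2 : ℂ) • (ι (σ 1) * ∫ u in t..s, U u))

lemma exists_partition {s δ : ℝ} (ht : 0 ≤ t) (hts : t ≤ s) (hδ : 0 < δ) :
    ∃ (τ : ℕ → ℝ) (m n : ℕ), m ≤ n ∧ Monotone τ ∧ τ 0 = 0 ∧ τ m = t ∧ τ n = s ∧
      ∀ k, τ (k + 1) - τ k < δ := by
  obtain ⟨N, hN⟩ := exists_nat_gt (max t (s - t) / δ)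
  have hN0 : (0 : ℝ) < N := lt_of_le_of_lt (by positivity) hN
  have hNpos : 0 < N := by exact_mod_cast hN0
  have hmax : max t (s - t) / N < δ := by
    rw [div_lt_iff₀ hδ] at hN
    rw [div_lt_iff₀ hN0]; linarith
  have h1 : t / N < δ := lt_of_le_of_lt (by gcongr; exact le_max_left _ _) hmax
  have h2 : (s - t) / N < δ := lt_of_le_of_lt (by gcongr; exact le_max_right _ _) hmax
  -- `N` equal steps on `[0, t]`, then `N` equal steps on `[t, s]`. Truncated subtraction keeps the
  -- second term at `0` up to `k = N`, and the minima make the sequence constant from `2 N` on.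
  refine ⟨fun k => (min k N : ℕ) * (t / N) + (min (k - N) N : ℕ) * ((s - t) / N), N, 2 * N,
    by omega, ?_, by simp, ?_, ?_, ?_⟩
  · refine monotone_nat_of_le_succ fun k => ?_
    have : (0 : ℝ) ≤ t / N := by positivity
    have : (0 : ℝ) ≤ (s - t) / N := div_nonneg (by linarith) hN0.le
    have h3 : min k N ≤ min (k + 1) N := by omega
    have h4 : min (k - N) N ≤ min (k + 1 - N) N := by omega
    gcongr
  · simp; field_simp
  · have h3 : min (2 * N) N = N := by omega
    have h4 : min (2 * N - N) N = N := by omega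
    simp only [h3, h4]
    field_simp; ring
  · intro k
    dsimp only
    have e1 : (0 : ℝ) ≤ t / N := by positivity
    have e2 : (0 : ℝ) ≤ (s - t) / N := div_nonneg (by linarith) hN0.le
    by_cases hk : k < N
    · have h3 : min (k + 1) N = min k N + 1 := by omega
      have h4 : min (k + 1 - N) N = min (k - N) N := by omega
      rw [h3, h4]; push_cast; linarith
    · by_cases hk2 : k < 2 * N
      · have h3 : min (k + 1) N = min k N := by omega
        have h4 : min (k + 1 - N) N = min (k - N) N + 1 := by omega
        rw [h3, h4]; push_cast; linarith
      · have h3 : min (k + 1) N = min k N := by omega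
        have h4 : min (k + 1 - N) N = min (k - N) N := by omega
        rw [h3, h4]; linarith

lemma IsEvolution.intervalIntegrable (hU : IsEvolution ι σ X U) {s : ℝ} (ht : 0 ≤ t)
    (hs : 0 ≤ s) : IntervalIntegrable U MeasureTheory.volume t s :=
  (hU.continuousOn.mono fun _ hx => (le_min ht hs).trans hx.1).intervalIntegrable

lemma IsEvolution.sub_eq (U : ℝ → A) (t s : ℝ) :
    U s - U t = Complex.I • martingaleIncrement ι σ U t s
      - (1 / 2 : ℂ) • (ι (σ 1) * ∫ u in t..s, U u) := by
  rw [martingaleIncrement, smul_smul]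
  simp

/-- The integrals start at `0`, so the increment is a difference of two of them. A fine partition of
`[0, s]` through `t` approximates both, and subtracting its part before `t` leaves a Riemann sum
over `[t, s]`. -/
lemma IsEvolution.martingaleIncrement_mem (hU : IsEvolution ι σ X U) (ht : 0 ≤ t) {s : ℝ}
    (hts : t ≤ s) : martingaleIncrement ι σ U t s ∈ closure (riemannSums X U t s) := by
  obtain ⟨I₁, hI₁, h₁⟩ := hU.sde t ht
  obtain ⟨I₂, hI₂, h₂⟩ := hU.sde s (ht.trans hts)
  have hM : martingaleIncrement ι σ U t s = I₂ - I₁ := by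
    have hint := intervalIntegral.integral_add_adjacent_intervals
      (hU.intervalIntegrable le_rfl ht) (hU.intervalIntegrable ht (ht.trans hts))
    have : U s - U t + (1 / 2 : ℂ) • (ι (σ 1) * ∫ u in t..s, U u) = Complex.I • (I₂ - I₁) := by
      rw [h₁, h₂, ← hint, mul_add, smul_add, smul_sub]; abel
    rw [martingaleIncrement, this, smul_smul]
    simp
  rw [hM, Metric.mem_closure_iff]
  intro ε hε
  obtain ⟨δ₁, hδ₁, hI₁⟩ := hI₁ (ε / 2) (half_pos hε)
  obtain ⟨δ₂, hδ₂, hI₂⟩ := hI₂ (ε / 2) (half_pos hε)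
  obtain ⟨τ, m, n, hmn, hτ, hτ0, hτm, hτn, hmesh⟩ := exists_partition ht hts (lt_min hδ₁ hδ₂)
  have e₁ := hI₁ m τ hτ hτ0 hτm fun k _ => (hmesh k).trans_le (min_le_left _ _)
  have e₂ := hI₂ n τ hτ hτ0 hτn fun k _ => (hmesh k).trans_le (min_le_right _ _)
  obtain ⟨p, rfl⟩ := Nat.exists_eq_add_of_le hmn
  refine ⟨riemannSum X (fun _ => 1) U (fun k => τ (m + k)) p,
    ⟨p, fun k => τ (m + k), fun k l hkl => hτ (by omega), hτm, hτn, rfl⟩, ?_⟩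
  rw [Finset.sum_range_add] at e₂
  have : riemannSum X (fun _ => 1) U (fun k => τ (m + k)) p =
      ∑ x ∈ Finset.range p, 1 * (X (τ (m + x + 1)) - X (τ (m + x))) * U (τ (m + x)) := rfl
  rw [dist_comm, dist_eq_norm, this]
  set P := ∑ k ∈ Finset.range m, 1 * (X (τ (k + 1)) - X (τ k)) * U (τ k)
  set Q := ∑ x ∈ Finset.range p, 1 * (X (τ (m + x + 1)) - X (τ (m + x))) * U (τ (m + x))
  calc ‖Q - (I₂ - I₁)‖ = ‖(P + Q - I₂) - (P - I₁)‖ := by congr 1; abel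
    _ ≤ ‖P + Q - I₂‖ + ‖P - I₁‖ := norm_sub_le _ _
    _ < ε := by linarith

lemma IsEvolution.isSlope_integral (hU : IsEvolution ι σ X U) (ht : 0 ≤ t) :
    IsSlope t (fun s => ∫ u in t..s, U u) (U t) := by
  unfold IsSlope
  rw [Asymptotics.isLittleO_iff]
  intro ε hε
  have hc : ContinuousWithinAt U (Ici t) t :=
    (hU.continuousOn t ht).mono fun x (hx : t ≤ x) => ht.trans hx
  obtain ⟨δ, hδ, h1⟩ := (Metric.continuousWithinAt_iff.1 hc) ε hε
  have h2 : Ioo t (t + δ) ∈ 𝓝[>] t := Ioo_mem_nhdsGT (by linarith)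
  filter_upwards [h2] with s hs
  have h3 : (∫ u in t..s, U u) - (s - t) • U t = ∫ u in t..s, (U u - U t) := by
    rw [intervalIntegral.integral_sub (hU.intervalIntegrable ht (ht.trans hs.1.le))
      intervalIntegrable_const, intervalIntegral.integral_const]
  rw [h3]
  refine intervalIntegral.norm_integral_le_of_norm_le_const fun u hu => ?_
  rw [uIoc_of_le hs.1.le] at hu
  have := h1 (x := u) hu.1.le (by
    rw [Real.dist_eq, abs_of_nonneg (by linarith [hu.1])]; linarith [hu.2, hs.2])
  rw [dist_eq_norm] at this
  exact this.le

end Asymptotics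

/-! ### Cauchy–Schwarz type bounds for a positive map. -/

section CauchySchwarz

variable {D A : Type*} [CStarAlgebra D] [PartialOrder D] [StarOrderedRing D]
  [CStarAlgebra A] [PartialOrder A] [StarOrderedRing A] (E : A →ₚ[ℂ] D)

lemma norm_map_le_of_nonneg_of_le {x y : A} (hx : 0 ≤ x) (hxy : x ≤ y) : ‖E x‖ ≤ ‖E y‖ :=
  CStarAlgebra.norm_le_norm_of_nonneg_of_le (map_nonneg E hx) (OrderHomClass.mono E hxy)

lemma norm_map_star_add_mul_add_le (x y : A) :
    ‖E (star (x + y) * (x + y))‖ ≤ 2 * (‖E (star x * x)‖ + ‖E (star y * y)‖) := by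
  have h1 : star (x + y) * (x + y) ≤ (2 : ℂ) • (star x * x) + (2 : ℂ) • (star y * y) := by
    rw [← sub_nonneg]
    have : (2 : ℂ) • (star x * x) + (2 : ℂ) • (star y * y) - star (x + y) * (x + y) =
        star (x - y) * (x - y) := by
      simp only [two_smul, star_add, star_sub]
      noncomm_ring
    rw [this]
    exact star_mul_self_nonneg _
  refine (norm_map_le_of_nonneg_of_le E (star_mul_self_nonneg _) h1).trans ?_
  rw [map_add, map_smul, map_smul]
  refine (norm_add_le _ _).trans ?_
  rw [norm_smul, norm_smul]
  norm_num [mul_add]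

lemma norm_map_add_mul_star_add_le (x y : A) :
    ‖E ((x + y) * star (x + y))‖ ≤ 2 * (‖E (x * star x)‖ + ‖E (y * star y)‖) := by
  simpa using norm_map_star_add_mul_add_le E (star x) (star y)

lemma norm_map_star_mul_mul_le (b x : A) :
    ‖E (star (b * x) * (b * x))‖ ≤ ‖b‖ ^ 2 * ‖E (star x * x)‖ := by
  have h1 : star (b * x) * (b * x) ≤ ‖star b * b‖ • (star x * x) := by
    have := CStarAlgebra.star_left_conjugate_le_norm_smul (a := x) (b := star b * b)
      (IsSelfAdjoint.star_mul_self b)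
    simpa [mul_assoc] using this
  have h2 : ‖star b * b‖ = ‖b‖ ^ 2 := by rw [CStarRing.norm_star_mul_self, sq]
  refine (norm_map_le_of_nonneg_of_le E (star_mul_self_nonneg _) h1).trans ?_
  rw [h2, PositiveLinearMap.map_smul_of_tower, norm_smul, Real.norm_of_nonneg (by positivity)]

lemma norm_map_mul_mul_star_le (x b : A) :
    ‖E ((x * b) * star (x * b))‖ ≤ ‖b‖ ^ 2 * ‖E (x * star x)‖ := by
  simpa using norm_map_star_mul_mul_le E (star b) (star x)

/-- Polarization writes `4 x y` through the four squares of `y + ζ x*`, `ζ⁴ = 1`, and each square is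
controlled by the parallelogram bound. Only positivity of `E` is used. -/
lemma norm_map_mul_le_add (x y : A) :
    ‖E (x * y)‖ ≤ 2 * (‖E (x * star x)‖ + ‖E (star y * y)‖) := by
  have hpol : (4 : ℂ) • (x * y) =
      star (y + star x) * (y + star x) - star (y + -star x) * (y + -star x)
      + Complex.I • (star (y + Complex.I • star x) * (y + Complex.I • star x))
      - Complex.I • (star (y + -Complex.I • star x) * (y + -Complex.I • star x)) := by
    simp only [star_add, star_smul, star_star, star_neg, add_mul, mul_add, smul_add,
      smul_mul_assoc, mul_smul_comm, smul_smul, neg_smul, smul_neg, neg_mul, mul_neg, neg_neg,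
      RCLike.star_def, Complex.conj_I, Complex.I_mul_I]
    module
  have hb : ∀ ζ : ℂ, ‖ζ‖ = 1 → ‖E (star (y + ζ • star x) * (y + ζ • star x))‖ ≤
      2 * (‖E (x * star x)‖ + ‖E (star y * y)‖) := by
    intro ζ hζ
    have := norm_map_star_add_mul_add_le E y (ζ • star x)
    have h2 : star (ζ • star x) * (ζ • star x) = x * star x := by
      rw [star_smul, star_star, smul_mul_smul_comm, RCLike.star_def, ← Complex.normSq_eq_conj_mul_self,
        Complex.normSq_eq_norm_sq, hζ]
      simp
    rw [h2, add_comm ‖E (star y * y)‖] at this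
    exact this
  have h1 := hb 1 (by simp)
  have h2 := hb (-1) (by simp)
  have h3 := hb Complex.I (by simp)
  have h4 := hb (-Complex.I) (by simp)
  rw [one_smul] at h1
  rw [neg_one_smul] at h2
  set M := 2 * (‖E (x * star x)‖ + ‖E (star y * y)‖)
  have : ‖(4 : ℂ) • E (x * y)‖ ≤ M + M + M + M := by
    rw [← map_smul, hpol, map_sub, map_add, map_sub, map_smul, map_smul]
    refine (norm_sub_le _ _).trans (add_le_add ((norm_add_le _ _).trans (add_le_add
      ((norm_sub_le _ _).trans (add_le_add h1 h2)) ?_)) ?_) <;>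
    rw [norm_smul, Complex.norm_I, one_mul] <;> assumption
  rw [norm_smul] at this
  norm_num at this
  linarith

/-- Replacing `x, y` by `√r x, y / √r` leaves the product unchanged. The free weight `r` makes the
additive bound as useful as the product form of Cauchy–Schwarz. -/
lemma norm_map_mul_le_add_smul (x y : A) {r : ℝ} (hr : 0 < r) :
    ‖E (x * y)‖ ≤ 2 * (r * ‖E (x * star x)‖ + r⁻¹ * ‖E (star y * y)‖) := by
  have hs : 0 < √r := Real.sqrt_pos.2 hr
  have h1 : x * y = (√r • x) * ((√r)⁻¹ • y) := by
    rw [smul_mul_smul_comm, mul_inv_cancel₀ hs.ne', one_smul]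
  have h2 : (√r • x) * star (√r • x) = r • (x * star x) := by
    rw [star_smul, smul_mul_smul_comm, star_trivial, Real.mul_self_sqrt hr.le]
  have h3 : star ((√r)⁻¹ • y) * ((√r)⁻¹ • y) = r⁻¹ • (star y * y) := by
    rw [star_smul, smul_mul_smul_comm, star_trivial, ← mul_inv, Real.mul_self_sqrt hr.le]
  have := norm_map_mul_le_add E (√r • x) ((√r)⁻¹ • y)
  rw [← h1, h2, h3, PositiveLinearMap.map_smul_of_tower, PositiveLinearMap.map_smul_of_tower,
    norm_smul, norm_smul, Real.norm_of_nonneg hr.le, Real.norm_of_nonneg (by positivity)] at this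
  exact this

variable {E} {t : ℝ} {x y : ℝ → A}

lemma isLittleO_map_mul_of_left (hx : (fun s => E (x s * star (x s))) =o[𝓝[>] t] fun s => s - t)
    (hy : (fun s => E (star (y s) * y s)) =O[𝓝[>] t] fun s => s - t) :
    (fun s => E (x s * y s)) =o[𝓝[>] t] fun s => s - t := by
  obtain ⟨K, hK, hyK⟩ := hy.exists_pos
  rw [Asymptotics.isLittleO_iff]
  intro ε hε
  -- With this weight the `y`-term contributes `ε / 2`. The smallness asked of the `x`-term next is
  -- chosen to contribute the other half.
  have hr : 0 < 4 * K / ε := by positivity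
  filter_upwards [hyK.bound, (Asymptotics.isLittleO_iff.1 hx) (c := ε / (4 * (4 * K / ε)))
    (by positivity)] with s h1 h2
  refine (norm_map_mul_le_add_smul E _ _ hr).trans ?_
  calc 2 * (4 * K / ε * ‖E (x s * star (x s))‖ + (4 * K / ε)⁻¹ * ‖E (star (y s) * y s)‖)
      ≤ 2 * (4 * K / ε * (ε / (4 * (4 * K / ε)) * ‖s - t‖) + (4 * K / ε)⁻¹ * (K * ‖s - t‖)) := by
        gcongr
    _ = ε * ‖s - t‖ := by field_simp; ring

lemma isLittleO_map_mul_of_right (hx : (fun s => E (x s * star (x s))) =O[𝓝[>] t] fun s => s - t)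
    (hy : (fun s => E (star (y s) * y s)) =o[𝓝[>] t] fun s => s - t) :
    (fun s => E (x s * y s)) =o[𝓝[>] t] fun s => s - t := by
  have := isLittleO_map_mul_of_left (E := E) (x := fun s => star (y s)) (y := fun s => star (x s))
    (t := t) (by simpa using hy) (by simpa using hx)
  refine Asymptotics.IsBigO.trans_isLittleO ?_ this
  refine Asymptotics.IsBigO.of_bound 1 (Eventually.of_forall fun s => ?_)
  rw [← star_mul, map_star, norm_star, one_mul]

end CauchySchwarz

/-! ### Calculus of small and negligible families. -/

section Small

variable {D A : Type*} [CStarAlgebra D] [PartialOrder D] [StarOrderedRing D]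
  [CStarAlgebra A] [PartialOrder A] [StarOrderedRing A]

/-- A family of elements tending to `0` whose `E`-seminorms, with coefficients in `B`, are
`O(√(s - t))`. -/
structure IsSmall (E : A →ₚ[ℂ] D) (B : StarSubalgebra ℂ A) (t : ℝ) (x : ℝ → A) : Prop where
  tendsto : Tendsto x (𝓝[>] t) (𝓝 0)
  row : ∀ a ∈ B, (fun s => E ((a * x s) * star (a * x s))) =O[𝓝[>] t] fun s => s - t
  col : ∀ c ∈ B, (fun s => E (star (x s * c) * (x s * c))) =O[𝓝[>] t] fun s => s - t

/-- A family of elements tending to `0` whose `E`-seminorms, with coefficients in `B`, are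
`o(√(s - t))`. -/
structure IsNegligible (E : A →ₚ[ℂ] D) (B : StarSubalgebra ℂ A) (t : ℝ) (x : ℝ → A) : Prop where
  tendsto : Tendsto x (𝓝[>] t) (𝓝 0)
  row : ∀ a ∈ B, (fun s => E ((a * x s) * star (a * x s))) =o[𝓝[>] t] fun s => s - t
  col : ∀ c ∈ B, (fun s => E (star (x s * c) * (x s * c))) =o[𝓝[>] t] fun s => s - t

variable {E : A →ₚ[ℂ] D} {B : StarSubalgebra ℂ A} {t : ℝ} {x y x' y' w : ℝ → A} {a b c : A}

lemma IsNegligible.isSmall (h : IsNegligible E B t x) : IsSmall E B t x :=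
  ⟨h.tendsto, fun a ha => (h.row a ha).isBigO, fun c hc => (h.col c hc).isBigO⟩

lemma isBigO_of_norm_le {f : ℝ → D} {g : ℝ → ℝ} {l : Filter ℝ} (h : ∀ s, ‖f s‖ ≤ g s) :
    f =O[l] g :=
  Asymptotics.IsBigO.of_norm_le h

lemma IsSmall.star (h : IsSmall E B t x) : IsSmall E B t (fun s => star (x s)) := by
  refine ⟨by simpa using h.tendsto.star, fun a ha => ?_, fun c hc => ?_⟩
  · simpa using h.col (Star.star a) (star_mem ha)
  · simpa using h.row (Star.star c) (star_mem hc)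

lemma IsNegligible.star (h : IsNegligible E B t x) : IsNegligible E B t (fun s => star (x s)) := by
  refine ⟨by simpa using h.tendsto.star, fun a ha => ?_, fun c hc => ?_⟩
  · simpa using h.col (Star.star a) (star_mem ha)
  · simpa using h.row (Star.star c) (star_mem hc)

lemma IsSmall.add (hx : IsSmall E B t x) (hy : IsSmall E B t y) :
    IsSmall E B t (fun s => x s + y s) := by
  refine ⟨by simpa using hx.tendsto.add hy.tendsto, fun a ha => ?_, fun c hc => ?_⟩
  · refine (isBigO_of_norm_le fun s => ?_).trans
      (((hx.row a ha).norm_left.add (hy.row a ha).norm_left).const_mul_left 2)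
    rw [mul_add]
    exact norm_map_add_mul_star_add_le E _ _
  · refine (isBigO_of_norm_le fun s => ?_).trans
      (((hx.col c hc).norm_left.add (hy.col c hc).norm_left).const_mul_left 2)
    rw [add_mul]
    exact norm_map_star_add_mul_add_le E _ _

lemma IsNegligible.add (hx : IsNegligible E B t x) (hy : IsNegligible E B t y) :
    IsNegligible E B t (fun s => x s + y s) := by
  refine ⟨by simpa using hx.tendsto.add hy.tendsto, fun a ha => ?_, fun c hc => ?_⟩
  · refine (isBigO_of_norm_le fun s => ?_).trans_isLittleO
      (((hx.row a ha).norm_left.add (hy.row a ha).norm_left).const_mul_left 2)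
    rw [mul_add]
    exact norm_map_add_mul_star_add_le E _ _
  · refine (isBigO_of_norm_le fun s => ?_).trans_isLittleO
      (((hx.col c hc).norm_left.add (hy.col c hc).norm_left).const_mul_left 2)
    rw [add_mul]
    exact norm_map_star_add_mul_add_le E _ _

lemma IsSmall.const_mul (hx : IsSmall E B t x) (hb : b ∈ B) :
    IsSmall E B t (fun s => b * x s) := by
  refine ⟨by simpa using hx.tendsto.const_mul b, fun a ha => ?_, fun c hc => ?_⟩
  · simpa only [mul_assoc] using hx.row (a * b) (mul_mem ha hb)
  · refine (isBigO_of_norm_le fun s => ?_).trans ((hx.col c hc).norm_left.const_mul_left (‖b‖ ^ 2))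
    rw [mul_assoc]
    exact norm_map_star_mul_mul_le E _ _

lemma IsNegligible.const_mul (hx : IsNegligible E B t x) (hb : b ∈ B) :
    IsNegligible E B t (fun s => b * x s) := by
  refine ⟨by simpa using hx.tendsto.const_mul b, fun a ha => ?_, fun c hc => ?_⟩
  · simpa only [mul_assoc] using hx.row (a * b) (mul_mem ha hb)
  · refine (isBigO_of_norm_le fun s => ?_).trans_isLittleO
      ((hx.col c hc).norm_left.const_mul_left (‖b‖ ^ 2))
    rw [mul_assoc]
    exact norm_map_star_mul_mul_le E _ _

lemma IsSmall.mul_const (hx : IsSmall E B t x) (hb : b ∈ B) :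
    IsSmall E B t (fun s => x s * b) := by
  simpa using (hx.star.const_mul (star_mem hb)).star

lemma IsNegligible.mul_const (hx : IsNegligible E B t x) (hb : b ∈ B) :
    IsNegligible E B t (fun s => x s * b) := by
  simpa using (hx.star.const_mul (star_mem hb)).star

lemma IsSmall.const_smul (hx : IsSmall E B t x) (r : ℂ) : IsSmall E B t (fun s => r • x s) := by
  simpa [Algebra.smul_def] using hx.const_mul (algebraMap_mem B r)

lemma IsNegligible.const_smul (hx : IsNegligible E B t x) (r : ℂ) :
    IsNegligible E B t (fun s => r • x s) := by
  simpa [Algebra.smul_def] using hx.const_mul (algebraMap_mem B r)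

lemma isLittleO_of_norm_le_mul {f : ℝ → D} {g : ℝ → ℝ} {k : ℝ → D}
    (h : ∀ s, ‖f s‖ ≤ g s * ‖k s‖) (hg : Tendsto g (𝓝[>] t) (𝓝 0))
    (hk : k =O[𝓝[>] t] fun s => s - t) : f =o[𝓝[>] t] fun s => s - t := by
  refine (isBigO_of_norm_le h).trans_isLittleO ?_
  have := ((Asymptotics.isLittleO_one_iff ℝ).2 hg).mul_isBigO hk.norm_left
  simpa using this

/-- One factor supplies the rate `√(s - t)` in the seminorm, the other only a norm tending to `0`:
`x` gives the rate for rows and `y` for columns. -/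
lemma IsSmall.mul (hx : IsSmall E B t x) (hy : IsSmall E B t y) (hw : Tendsto w (𝓝[>] t) (𝓝 b)) :
    IsNegligible E B t (fun s => x s * w s * y s) := by
  have h1 : Tendsto (fun s => ‖x s * w s‖ ^ 2) (𝓝[>] t) (𝓝 0) := by
    simpa using ((hx.tendsto.mul hw).norm.pow 2)
  have h2 : Tendsto (fun s => ‖w s * y s‖ ^ 2) (𝓝[>] t) (𝓝 0) := by
    simpa using ((hw.mul hy.tendsto).norm.pow 2)
  refine ⟨by simpa using (hx.tendsto.mul hw).mul hy.tendsto, fun a ha => ?_, fun c hc => ?_⟩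
  · refine isLittleO_of_norm_le_mul (fun s => ?_) h2 (hx.row a ha)
    rw [show a * (x s * w s * y s) = (a * x s) * (w s * y s) by simp only [mul_assoc]]
    exact norm_map_mul_mul_star_le E _ _
  · refine isLittleO_of_norm_le_mul (fun s => ?_) h1 (hy.col c hc)
    rw [show (x s * w s * y s) * c = (x s * w s) * (y s * c) by simp only [mul_assoc]]
    exact norm_map_star_mul_mul_le E _ _

/-- A family of norm `O(s - t)` is negligible. -/
lemma isNegligible_of_isBigO (hx : x =O[𝓝[>] t] fun s => s - t) : IsNegligible E B t x := by
  have hlim : Tendsto (fun s => s - t) (𝓝[>] t) (𝓝 0) := by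
    have : Tendsto (fun s => s - t) (𝓝 t) (𝓝 (t - t)) := (continuous_id.sub continuous_const).tendsto t
    rw [sub_self] at this
    exact this.mono_left nhdsWithin_le_nhds
  have hx0 : Tendsto x (𝓝[>] t) (𝓝 0) := hx.trans_tendsto hlim
  have h1 : (fun s => ‖x s‖ ^ 2) =o[𝓝[>] t] fun s => s - t := by
    have := ((Asymptotics.isLittleO_one_iff ℝ).2 hx0).norm_left.mul_isBigO hx.norm_left
    simpa [sq] using this
  refine ⟨hx0, fun a _ => ?_, fun c _ => ?_⟩
  · refine (isBigO_of_norm_le fun s => norm_map_mul_mul_star_le E a (x s)).trans_isLittleO ?_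
    simpa [mul_comm] using h1.const_mul_left ‖E (a * star a)‖
  · refine (isBigO_of_norm_le fun s => norm_map_star_mul_mul_le E (x s) c).trans_isLittleO ?_
    simpa [mul_comm] using h1.const_mul_left ‖E (star c * c)‖

lemma IsNegligible.congr' (hx : IsNegligible E B t x) (h : x =ᶠ[𝓝[>] t] y) :
    IsNegligible E B t y := by
  refine ⟨hx.tendsto.congr' h, fun a ha => (hx.row a ha).congr' ?_ EventuallyEq.rfl,
    fun c hc => (hx.col c hc).congr' ?_ EventuallyEq.rfl⟩ <;>
  filter_upwards [h] with s hs <;> rw [hs]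

/-- Products of two small families may be evaluated modulo negligible families. -/
lemma isLittleO_map_bilin (hx : IsNegligible E B t (fun s => x s - x' s)) (hx' : IsSmall E B t x')
    (hy : IsNegligible E B t (fun s => y s - y' s)) (hy' : IsSmall E B t y')
    (hw : Tendsto w (𝓝[>] t) (𝓝 b)) (ha : a ∈ B) (hc : c ∈ B) :
    (fun s => E (a * x s * w s * y s * c) - E (a * x' s * b * y' s * c))
      =o[𝓝[>] t] fun s => s - t := by
  have hys : IsSmall E B t y := by
    simpa using hy.isSmall.add hy'
  -- The three factors are replaced one at a time: `x` by `x'`, then `w` by its limit `b`, then `y`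
  -- by `y'`.
  have e1 : (fun s => E ((a * (x s - x' s)) * (w s * (y s * c)))) =o[𝓝[>] t] fun s => s - t := by
    refine isLittleO_map_mul_of_left (hx.row a ha) ?_
    refine (isBigO_of_norm_le fun s => norm_map_star_mul_mul_le E _ _).trans ?_
    have := ((hw.norm.pow 2).isBigO_one ℝ).mul (hys.col c hc).norm_left
    simpa using this
  have e2 : (fun s => E ((a * x' s) * ((w s - b) * (y s * c)))) =o[𝓝[>] t] fun s => s - t := by
    refine isLittleO_map_mul_of_right (hx'.row a ha) ?_
    refine isLittleO_of_norm_le_mul (fun s => norm_map_star_mul_mul_le E _ _) ?_ (hys.col c hc)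
    have : Tendsto (fun s => w s - b) (𝓝[>] t) (𝓝 0) := by simpa using hw.sub_const b
    simpa using this.norm.pow 2
  have e3 : (fun s => E ((a * x' s) * (b * ((y s - y' s) * c)))) =o[𝓝[>] t] fun s => s - t := by
    refine isLittleO_map_mul_of_right (hx'.row a ha) ?_
    refine (isBigO_of_norm_le fun s => norm_map_star_mul_mul_le E _ _).trans_isLittleO ?_
    exact (hy.col c hc).norm_left.const_mul_left _
  refine ((e1.add e2).add e3).congr_left fun s => ?_
  rw [← map_add, ← map_add, ← map_sub]
  congr 1
  noncomm_ring

end Small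

/-! ### Local expansion of `U`, of its adjoint or inverse, and of the flow. -/

section Local

variable {D A : Type*} [CStarAlgebra D] [PartialOrder D] [StarOrderedRing D]
  [CStarAlgebra A] [PartialOrder A] [StarOrderedRing A]
  {ι : D →⋆ₐ[ℂ] A} {E : A →ₚ[ℂ] D} {σ : D →CP D} {X U V : ℝ → A} {B : StarSubalgebra ℂ A}
  {t : ℝ} {J K w : ℝ → A} {u v p a b c : A}

/-- The map `x ↦ E (a x c)`. -/
def sandwich (E : A →ₚ[ℂ] D) (a c : A) : A →L[ℝ] D where
  toFun x := E (a * x * c)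
  map_add' x y := by simp [mul_add, add_mul]
  map_smul' r x := by simp
  cont := by
    have hEc : Continuous E := map_continuous E
    fun_prop

@[simp]
lemma sandwich_apply (a c x : A) : sandwich E a c x = E (a * x * c) := rfl

/-- First order expansions at time `t+` of `U`, with martingale part `i J` and initial value `u`,
and of `V`, with martingale part `-i K` and initial value `v`, where `dJ = dX u`, `dK = v dX`. -/
structure HasExpansion (ι : D →⋆ₐ[ℂ] A) (E : A →ₚ[ℂ] D) (σ : D →CP D) (B : StarSubalgebra ℂ A)
    (t : ℝ) (U V J K : ℝ → A) (u v : A) : Prop where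
  mem_left : u ∈ B
  mem_right : v ∈ B
  small_left : IsSmall E B t J
  small_right : IsSmall E B t K
  negligible_left : IsNegligible E B t fun s => U s - u - Complex.I • J s
  negligible_right : IsNegligible E B t fun s => V s - v - (-Complex.I) • K s
  drift_left : ∀ a ∈ B, ∀ c ∈ B, IsSlope t (fun s => E (a * (U s - u) * c))
    (-(1 / 2 : ℂ) • E (a * ι (σ 1) * u * c))
  drift_right : ∀ a ∈ B, ∀ c ∈ B, IsSlope t (fun s => E (a * (V s - v) * c))
    (-(1 / 2 : ℂ) • E (a * v * ι (σ 1) * c))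
  left_left : ∀ a ∈ B, ∀ b ∈ B, ∀ c ∈ B, IsSlope t (fun s => E (a * J s * b * J s * c))
    (E (a * ι (σ (E (u * b))) * u * c))
  left_right : ∀ a ∈ B, ∀ b ∈ B, ∀ c ∈ B, IsSlope t (fun s => E (a * J s * b * K s * c))
    (E (a * ι (σ (E (u * b * v))) * c))
  right_left : ∀ a ∈ B, ∀ b ∈ B, ∀ c ∈ B, IsSlope t (fun s => E (a * K s * b * J s * c))
    (E (a * v * ι (σ (E b)) * u * c))
  right_right : ∀ a ∈ B, ∀ b ∈ B, ∀ c ∈ B, IsSlope t (fun s => E (a * K s * b * K s * c))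
    (E (a * v * ι (σ (E (b * v))) * c))

namespace HasExpansion

/-- Itô's product rule: `dU p v + u p dV` gives the two drifts and `dU p dV` the correction, with
sign `i · (-i) = 1`. -/
lemma isSlope_first (h : HasExpansion ι E σ B t U V J K u v) (hp : p ∈ B) (ha : a ∈ B)
    (hc : c ∈ B) :
    IsSlope t (fun s => E (a * (U s * p * V s - u * p * v) * c))
      (E (a * ι (σ (E (u * p * v))) * c)
        - (1 / 2 : ℂ) • (E (a * ι (σ 1) * (u * p * v) * c) + E (a * (u * p * v) * ι (σ 1) * c))) := by
  have hu := h.mem_left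
  have hv := h.mem_right
  have h1 := h.drift_left a ha (p * v * c) (mul_mem (mul_mem hp hv) hc)
  have h2 := h.drift_right (a * u * p) (mul_mem (mul_mem ha hu) hp) c hc
  have h3 := (h.left_right a ha p hp c hc).congr_littleO
    (g := fun s => E (a * (U s - u) * p * (V s - v) * c)) (by
      have := isLittleO_map_bilin h.negligible_left (h.small_left.const_smul Complex.I)
        h.negligible_right (h.small_right.const_smul (-Complex.I))
        (tendsto_const_nhds (x := p)) ha hc
      refine this.congr_left fun s => ?_
      simp only [mul_smul_comm, smul_mul_assoc, smul_smul, neg_smul, mul_neg,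
        Complex.I_mul_I, neg_neg, one_smul])
  have h4 := (h1.add h2).add h3
  convert h4 using 2 with s
  · rw [← map_add, ← map_add]
    congr 1
    noncomm_ring
  · simp only [mul_assoc]
    module

/-- The correction `dU p dV`, which counts in `isSlope_first`, may be dropped here: this expansion
serves only inside products with a second increment of the flow. -/
lemma negligible_flow (h : HasExpansion ι E σ B t U V J K u v) (hp : p ∈ B) :
    IsNegligible E B t fun s => (U s * p * V s - u * p * v)
      - (Complex.I • (J s * (p * v)) - Complex.I • (u * p * K s)) := by
  have hu := h.mem_left
  have hv := h.mem_right
  have h1 := h.negligible_left.mul_const (mul_mem hp hv)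
  have h2 := h.negligible_right.const_mul (mul_mem hu hp)
  have hU : IsSmall E B t fun s => U s - u := by
    simpa using h.negligible_left.isSmall.add (h.small_left.const_smul Complex.I)
  have hV : IsSmall E B t fun s => V s - v := by
    simpa using h.negligible_right.isSmall.add (h.small_right.const_smul (-Complex.I))
  have h3 := hU.mul hV (tendsto_const_nhds (x := p))
  convert (h1.add h2).add h3 using 2 with s
  simp only [sub_mul, mul_sub, mul_smul_comm, smul_mul_assoc, neg_smul, mul_neg, mul_assoc]
  abel

lemma small_flow (h : HasExpansion ι E σ B t U V J K u v) (hp : p ∈ B) :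
    IsSmall E B t fun s => Complex.I • (J s * (p * v)) - Complex.I • (u * p * K s) := by
  have h1 := (h.small_left.mul_const (mul_mem hp h.mem_right)).const_smul Complex.I
  have h2 := (h.small_right.const_mul (mul_mem h.mem_left hp)).const_smul (-Complex.I)
  simpa [sub_eq_add_neg] using h1.add h2

/-- Modulo negligible terms the flow increment is `i (J p v - u p K)`. Squaring gives the mixed
products with sign `+` and the pure products with sign `-`. -/
lemma isSlope_second (h : HasExpansion ι E σ B t U V J K u v) (hp : p ∈ B) (ha : a ∈ B)
    (hb : b ∈ B) (hc : c ∈ B) (hw : Tendsto w (𝓝[>] t) (𝓝 b)) :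
    IsSlope t (fun s => E (a * (U s * p * V s - u * p * v) * w s *
        (U s * p * V s - u * p * v) * c))
      (E (a * ι (σ (E (u * p * v * b * (u * p * v)))) * c)
        + E (a * (u * p * v) * ι (σ (E b)) * (u * p * v) * c)
        - E (a * ι (σ (E (u * p * v * b))) * (u * p * v) * c)
        - E (a * (u * p * v) * ι (σ (E (b * (u * p * v)))) * c)) := by
  have hu := h.mem_left
  have hv := h.mem_right
  refine IsSlope.congr_littleO ?_ (isLittleO_map_bilin (h.negligible_flow hp) (h.small_flow hp)
    (h.negligible_flow hp) (h.small_flow hp) hw ha hc)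
  have hpv := mul_mem hp hv
  have hup := mul_mem hu hp
  have h1 := h.left_left a ha (p * v * b) (mul_mem hpv hb) (p * v * c) (mul_mem hpv hc)
  have h2 := h.left_right a ha (p * v * b * (u * p)) (mul_mem (mul_mem hpv hb) hup) c hc
  have h3 := h.right_left (a * (u * p)) (mul_mem ha hup) b hb (p * v * c) (mul_mem hpv hc)
  have h4 := h.right_right (a * (u * p)) (mul_mem ha hup) (b * (u * p)) (mul_mem hb hup) c hc
  have h5 := ((h2.add h3).sub h1).sub h4
  convert h5 using 2 with s
  · rw [← map_add, ← map_sub, ← map_sub]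
    congr 1
    simp only [sub_mul, mul_sub, mul_smul_comm, smul_mul_assoc, smul_sub, smul_smul,
      mul_assoc, Complex.I_mul_I, neg_smul, one_smul, neg_mul]
    abel
  · simp only [mul_assoc]
  · simp only [mul_assoc]

end HasExpansion

lemma isSelfAdjoint_cp_one (σ : D →CP D) : IsSelfAdjoint (σ 1) := by
  rw [IsSelfAdjoint, ← map_star, star_one]

section Evolution

variable (hE : IsCondExp ι E) (hX : IsFreeBrownianMotion ι E σ X) (hU : IsEvolution ι σ X U)
  (ht : 0 ≤ t)

include hU ht

lemma IsEvolution.continuousWithinAt : ContinuousWithinAt U (Ici t) t :=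
  (hU.continuousOn t ht).mono fun _ hx => ht.trans hx

lemma IsEvolution.tendsto : Tendsto U (𝓝[>] t) (𝓝 (U t)) :=
  (hU.continuousWithinAt ht).tendsto.mono_left (nhdsWithin_mono _ Ioi_subset_Ici_self)

lemma IsEvolution.tendsto_martingaleIncrement :
    Tendsto (martingaleIncrement ι σ U t) (𝓝[>] t) (𝓝 0) := by
  have h1 : Tendsto (fun s => s - t) (𝓝[>] t) (𝓝 0) := by
    have : Tendsto (fun s => s - t) (𝓝 t) (𝓝 (t - t)) :=
      (continuous_id.sub continuous_const).tendsto t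
    rw [sub_self] at this
    exact this.mono_left nhdsWithin_le_nhds
  have h2 : Tendsto (fun s => ∫ u in t..s, U u) (𝓝[>] t) (𝓝 0) :=
    (hU.isSlope_integral ht).isBigO.trans_tendsto h1
  have h3 := (((hU.tendsto ht).sub_const (U t)).add
    ((h2.const_mul (ι (σ 1))).const_smul (1 / 2 : ℂ))).const_smul (-Complex.I)
  have h4 : martingaleIncrement ι σ U t = fun s =>
      (-Complex.I) • (U s - U t + (1 / 2 : ℂ) • (ι (σ 1) * ∫ u in t..s, U u)) := rfl
  rw [h4]
  convert h3 using 2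
  simp

lemma IsEvolution.negligible :
    IsNegligible E B t fun s => U s - U t - Complex.I • martingaleIncrement ι σ U t s := by
  refine isNegligible_of_isBigO ?_
  have := ((hU.isSlope_integral ht).isBigO.const_mul_left (ι (σ 1))).const_smul_left
    (-(1 / 2 : ℂ))
  refine this.congr_left fun s => ?_
  rw [IsEvolution.sub_eq (ι := ι) (σ := σ)]
  simp

include hE hX

lemma IsEvolution.map_martingaleIncrement (ha : a ∈ filtration ι X t)
    (hc : c ∈ filtration ι X t) {s : ℝ} (hs : t ≤ s) :
    E (a * martingaleIncrement ι σ U t s * c) = 0 :=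
  hX.map_integral hE ht (fun u hu => hU.adapted u (ht.trans hu)) (hU.martingaleIncrement_mem ht hs)
    ha hc

lemma IsEvolution.drift (ha : a ∈ filtration ι X t) (hc : c ∈ filtration ι X t) :
    IsSlope t (fun s => E (a * (U s - U t) * c)) (-(1 / 2 : ℂ) • E (a * ι (σ 1) * U t * c)) := by
  have h1 := ((hU.isSlope_integral ht).map (sandwich E (a * ι (σ 1)) c)).const_smul (-(1 / 2 : ℂ))
  refine IsSlope.congr' h1 ?_
  filter_upwards [self_mem_nhdsWithin] with s hs
  rw [IsEvolution.sub_eq (ι := ι) (σ := σ), mul_sub, sub_mul, map_sub, mul_smul_comm,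
    smul_mul_assoc, map_smul, hU.map_martingaleIncrement hE hX ht ha hc (le_of_lt hs)]
  simp [mul_assoc]

lemma IsEvolution.drift_star (ha : a ∈ filtration ι X t) (hc : c ∈ filtration ι X t) :
    IsSlope t (fun s => E (a * (star (U s) - star (U t)) * c))
      (-(1 / 2 : ℂ) • E (a * star (U t) * ι (σ 1) * c)) := by
  have h1 := (hU.drift hE hX ht (star_mem hc) (star_mem ha)).map
    (starL' ℝ : D ≃L[ℝ] D).toContinuousLinearMap
  have hs : star (ι (σ 1)) = ι (σ 1) := by rw [← map_star, (isSelfAdjoint_cp_one σ).star_eq]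
  have h2 : ∀ x, star (E x) = E (star x) := fun x => (map_star E x).symm
  convert h1 using 2 with s
  · simp [h2, mul_assoc]
  · simp [h2, hs, mul_assoc]

lemma IsEvolution.slope_mul_mul (ha : a ∈ filtration ι X t) (hb : b ∈ filtration ι X t)
    (hc : c ∈ filtration ι X t) :
    IsSlope t (fun s => E (a * martingaleIncrement ι σ U t s * b * martingaleIncrement ι σ U t s * c))
      (E (a * ι (σ (E (U t * b))) * U t * c)) := by
  have hcU := hU.continuousWithinAt ht
  have := hX.isSlope_integral₂ hE ht (F := fun _ => 1) (G := U) (F' := fun _ => 1) (G' := U)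
    (fun _ _ => one_mem _) (fun u hu => hU.adapted u (ht.trans hu))
    (fun _ _ => one_mem _) (fun u hu => hU.adapted u (ht.trans hu))
    continuousWithinAt_const hcU continuousWithinAt_const hcU ha hb hc
    (fun s hs => hU.martingaleIncrement_mem ht hs.le) (f := fun x => x) (g := fun x => x)
    continuous_id continuous_id (fun _ _ _ => rfl) (fun _ _ _ => rfl)
  simpa using this

lemma IsEvolution.slope_mul_star (ha : a ∈ filtration ι X t) (hb : b ∈ filtration ι X t)
    (hc : c ∈ filtration ι X t) :
    IsSlope t (fun s => E (a * martingaleIncrement ι σ U t s * b *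
        star (martingaleIncrement ι σ U t s) * c))
      (E (a * ι (σ (E (U t * b * star (U t)))) * c)) := by
  have hcU := hU.continuousWithinAt ht
  have := hX.isSlope_integral₂ hE ht (F := fun _ => 1) (G := U) (F' := fun s => star (U s))
    (G' := fun _ => 1)
    (fun _ _ => one_mem _) (fun u hu => hU.adapted u (ht.trans hu))
    (fun u hu => star_mem (hU.adapted u (ht.trans hu))) (fun _ _ => one_mem _)
    continuousWithinAt_const hcU hcU.star continuousWithinAt_const ha hb hc
    (fun s hs => hU.martingaleIncrement_mem ht hs.le) (f := fun x => x) (g := star)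
    continuous_id continuous_star (fun _ _ _ => rfl)
    (fun τ n hτ => by simpa using hX.star_riemannSum (fun _ => 1) U hτ n)
  simpa using this

lemma IsEvolution.slope_star_mul (ha : a ∈ filtration ι X t) (hb : b ∈ filtration ι X t)
    (hc : c ∈ filtration ι X t) :
    IsSlope t (fun s => E (a * star (martingaleIncrement ι σ U t s) * b *
        martingaleIncrement ι σ U t s * c))
      (E (a * star (U t) * ι (σ (E b)) * U t * c)) := by
  have hcU := hU.continuousWithinAt ht
  have := hX.isSlope_integral₂ hE ht (F := fun s => star (U s)) (G := fun _ => 1)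
    (F' := fun _ => 1) (G' := U)
    (fun u hu => star_mem (hU.adapted u (ht.trans hu))) (fun _ _ => one_mem _)
    (fun _ _ => one_mem _) (fun u hu => hU.adapted u (ht.trans hu))
    hcU.star continuousWithinAt_const continuousWithinAt_const hcU ha hb hc
    (fun s hs => hU.martingaleIncrement_mem ht hs.le) (f := star) (g := fun x => x)
    continuous_star continuous_id
    (fun τ n hτ => by simpa using hX.star_riemannSum (fun _ => 1) U hτ n) (fun _ _ _ => rfl)
  simpa using this

lemma IsEvolution.slope_star_star (ha : a ∈ filtration ι X t) (hb : b ∈ filtration ι X t)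
    (hc : c ∈ filtration ι X t) :
    IsSlope t (fun s => E (a * star (martingaleIncrement ι σ U t s) * b *
        star (martingaleIncrement ι σ U t s) * c))
      (E (a * star (U t) * ι (σ (E (b * star (U t)))) * c)) := by
  have hcU := hU.continuousWithinAt ht
  have := hX.isSlope_integral₂ hE ht (F := fun s => star (U s)) (G := fun _ => 1)
    (F' := fun s => star (U s)) (G' := fun _ => 1)
    (fun u hu => star_mem (hU.adapted u (ht.trans hu))) (fun _ _ => one_mem _)
    (fun u hu => star_mem (hU.adapted u (ht.trans hu))) (fun _ _ => one_mem _)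
    hcU.star continuousWithinAt_const hcU.star continuousWithinAt_const ha hb hc
    (fun s hs => hU.martingaleIncrement_mem ht hs.le) (f := star) (g := star)
    continuous_star continuous_star
    (fun τ n hτ => by simpa using hX.star_riemannSum (fun _ => 1) U hτ n)
    (fun τ n hτ => by simpa using hX.star_riemannSum (fun _ => 1) U hτ n)
  simpa using this

/-- The row and column bounds are the mixed entries of the Itô table with `b = 1`, since having a
slope implies being `O(s - t)`. -/
lemma IsEvolution.small : IsSmall E (filtration ι X t) t (martingaleIncrement ι σ U t) := by
  refine ⟨hU.tendsto_martingaleIncrement ht, fun a ha => ?_, fun c hc => ?_⟩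
  · have := (hU.slope_mul_star hE hX ht ha (one_mem _) (star_mem ha)).isBigO
    simpa [mul_assoc] using this
  · have := (hU.slope_star_mul hE hX ht (star_mem hc) (one_mem _) hc).isBigO
    simpa [mul_assoc] using this

lemma IsEvolution.hasExpansion_star :
    HasExpansion ι E σ (filtration ι X t) t U (fun s => star (U s)) (martingaleIncrement ι σ U t)
      (fun s => star (martingaleIncrement ι σ U t s)) (U t) (star (U t)) where
  mem_left := hU.adapted t ht
  mem_right := star_mem (hU.adapted t ht)
  small_left := hU.small hE hX ht
  small_right := (hU.small hE hX ht).star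
  negligible_left := hU.negligible ht
  negligible_right := by
    have := (hU.negligible (E := E) (B := filtration ι X t) ht).star
    simpa using this
  drift_left _ ha _ hc := hU.drift hE hX ht ha hc
  drift_right _ ha _ hc := hU.drift_star hE hX ht ha hc
  left_left _ ha _ hb _ hc := hU.slope_mul_mul hE hX ht ha hb hc
  left_right _ ha _ hb _ hc := hU.slope_mul_star hE hX ht ha hb hc
  right_left _ ha _ hb _ hc := hU.slope_star_mul hE hX ht ha hb hc
  right_right _ ha _ hb _ hc := hU.slope_star_star hE hX ht ha hb hc

/-- The resolvent identity, used twice, expands `V` to second order in `U s - U t`. Its martingale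
part is `-i V J V`, and `U t * V t = 1` turns the Itô table of `U` into the one required for `V`. -/
lemma IsEvolution.hasExpansion_inverse (hV : ∀ s, 0 ≤ s → U s * V s = 1 ∧ V s * U s = 1)
    (hVt : V t ∈ filtration ι X t) (hVc : Tendsto V (𝓝[>] t) (𝓝 (V t))) :
    HasExpansion ι E σ (filtration ι X t) t U V (martingaleIncrement ι σ U t)
      (fun s => V t * martingaleIncrement ι σ U t s * V t) (U t) (V t) := by
  have hJ := hU.small hE hX ht
  have hneg := hU.negligible (E := E) (B := filtration ι X t) ht
  have hdU : IsSmall E (filtration ι X t) t fun s => U s - U t := by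
    simpa using hneg.isSmall.add (hJ.const_smul Complex.I)
  have hV2 : ∀ s, 0 ≤ s → V s - V t =
      -(V t * (U s - U t) * V t) + V t * (U s - U t) * V s * ((U s - U t) * V t) := by
    intro s hs
    obtain ⟨h1, h2⟩ := hV s hs
    obtain ⟨h3, h4⟩ := hV t ht
    have e1 : V t * (U s - U t) * V s = V t - V s := by
      rw [mul_sub, sub_mul, mul_assoc, h1, h4, mul_one, one_mul]
    have e2 : V s * (U s - U t) * V t = V t - V s := by
      rw [mul_sub, sub_mul, h2, mul_assoc, h3, mul_one, one_mul]
    have e3 : V t * (U s - U t) * V s * ((U s - U t) * V t) =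
        V t * (U s - U t) * (V s * (U s - U t) * V t) := by simp only [mul_assoc]
    rw [e3, e2, mul_sub (V t * (U s - U t)), e1]
    abel
  have hts : ∀ᶠ s in 𝓝[>] t, 0 ≤ s := by
    filter_upwards [self_mem_nhdsWithin] with s hs using ht.trans (le_of_lt hs)
  refine
    { mem_left := hU.adapted t ht
      mem_right := hVt
      small_left := hJ
      small_right := (hJ.const_mul hVt).mul_const hVt
      negligible_left := hneg
      negligible_right := ?_
      drift_left := fun _ ha _ hc => hU.drift hE hX ht ha hc
      drift_right := ?_
      left_left := fun _ ha _ hb _ hc => hU.slope_mul_mul hE hX ht ha hb hc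
      left_right := ?_
      right_left := ?_
      right_right := ?_ }
  · have h1 := ((hneg.const_mul hVt).mul_const hVt).const_smul (-1)
    have h2 := (hdU.const_mul hVt).mul (hdU.mul_const hVt) hVc
    refine (h1.add h2).congr' ?_
    filter_upwards [hts] with s hs
    rw [hV2 s hs]
    simp only [mul_sub, sub_mul, mul_smul_comm, smul_mul_assoc, smul_sub, neg_smul, one_smul]
    abel
  · intro a ha c hc
    -- The first-order term contributes `+1/2` and the quadratic term `-1`, which add up to the
    -- drift coefficient `-1/2` of the adjoint.
    have h1 := (hU.drift hE hX ht (mul_mem ha hVt) (mul_mem hVt hc)).const_smul (-1)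
    have h2 := (hU.slope_mul_mul hE hX ht (mul_mem ha hVt) hVt (mul_mem hVt hc)).const_smul (-1)
    have h3 := h2.congr_littleO
      (g := fun s => E (a * V t * (U s - U t) * V s * (U s - U t) * (V t * c))) (by
        have := isLittleO_map_bilin hneg (hJ.const_smul Complex.I) hneg (hJ.const_smul Complex.I)
          hVc (mul_mem ha hVt) (mul_mem hVt hc)
        refine this.congr_left fun s => ?_
        simp only [mul_smul_comm, smul_mul_assoc, smul_smul, Complex.I_mul_I, map_smul])
    have h4 := (h1.add h3).congr' (g := fun s => E (a * (V s - V t) * c)) (by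
      filter_upwards [hts] with s hs
      rw [hV2 s hs, ← map_smul, ← map_add]
      congr 1
      simp only [neg_smul, one_smul]
      noncomm_ring)
    convert h4 using 1
    have e : U t * (V t * c) = c := by rw [← mul_assoc, (hV t ht).1, one_mul]
    simp only [(hV t ht).1, hE.map_one, mul_assoc, e]
    module
  · intro a ha b hb c hc
    have := hU.slope_mul_mul hE hX ht ha (mul_mem hb hVt) (mul_mem hVt hc)
    have e : U t * (V t * c) = c := by rw [← mul_assoc, (hV t ht).1, one_mul]
    simpa only [mul_assoc, e] using this
  · intro a ha b hb c hc
    have := hU.slope_mul_mul hE hX ht (mul_mem ha hVt) (mul_mem hVt hb) hc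
    have e : U t * (V t * b) = b := by rw [← mul_assoc, (hV t ht).1, one_mul]
    simpa only [mul_assoc, e] using this
  · intro a ha b hb c hc
    have := hU.slope_mul_mul hE hX ht (mul_mem ha hVt) (mul_mem (mul_mem hVt hb) hVt)
      (mul_mem hVt hc)
    have e : ∀ x, U t * (V t * x) = x := fun x => by rw [← mul_assoc, (hV t ht).1, one_mul]
    simpa only [mul_assoc, e] using this

end Evolution

end Local

/-! ### Words and their exact second-order expansion. -/

section Words

variable {D A : Type*} [CStarAlgebra D] [CStarAlgebra A] (ι : D →⋆ₐ[ℂ] A) (a a' : A)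

/-- The word `a Δ₁ a Δ₂ ⋯ a Δ_p`. -/
def preWord : List D → A
  | [] => 1
  | d :: ds => a * ι d * preWord ds

/-- The word `Δ₁ a Δ₂ a ⋯ Δ_p a`. -/
def postWord : List D → A
  | [] => 1
  | d :: ds => ι d * a * postWord ds

/-- The word `Δ₁ a Δ₂ a ⋯ a Δ_p`. -/
def innerWord : List D → A
  | [] => 1
  | d :: ds => ι d * preWord ι a ds

lemma preWord_mul (l : List D) : preWord ι a l * a = word ι a l := by
  induction l with
  | nil => simp [preWord, word]
  | cons d l ih => rw [preWord, word, mul_assoc, ih]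

lemma mul_postWord (l : List D) : a * postWord ι a l = word ι a l := by
  induction l with
  | nil => simp [postWord, word]
  | cons d l ih => rw [postWord, word, ← ih]; simp only [mul_assoc]

lemma word_append_cons (l l' : List D) (d : D) :
    word ι a (l ++ d :: l') = word ι a l * ι d * word ι a l' := by
  induction l with
  | nil => simp [word]
  | cons e l ih => rw [List.cons_append, word, ih, word]; simp only [mul_assoc]

lemma preWord_concat (l : List D) (d : D) :
    preWord ι a (l ++ [d]) = word ι a l * ι d := by
  induction l with
  | nil => simp [preWord, word]
  | cons e l ih => rw [List.cons_append, preWord, ih, word]; simp only [mul_assoc]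

lemma postWord_cons (l : List D) (d : D) : postWord ι a (d :: l) = ι d * word ι a l := by
  rw [postWord, mul_assoc, mul_postWord]

lemma innerWord_cons_mul (l : List D) (d : D) :
    innerWord ι a (d :: l) * a = ι d * word ι a l := by
  rw [innerWord, mul_assoc, preWord_mul]

lemma innerWord_cons_concat (l : List D) (d e : D) :
    innerWord ι a (d :: (l ++ [e])) = ι d * word ι a l * ι e := by
  rw [innerWord, preWord_concat, mul_assoc]

lemma mul_innerWord_concat (l : List D) (d : D) :
    a * innerWord ι a (l ++ [d]) = word ι a l * ι d := by
  cases l with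
  | nil => simp [innerWord, word, preWord]
  | cons e l => rw [List.cons_append, innerWord_cons_concat, word]; simp only [mul_assoc]

lemma word_sub_word (l : List D) :
    word ι a' l - word ι a l = ∑ i ∈ Finset.range (l.length + 1),
      preWord ι a (l.take i) * (a' - a) * postWord ι a' (l.drop i) := by
  induction l with
  | nil => simp [word, preWord, postWord]
  | cons d l ih =>
    rw [List.length_cons, Finset.sum_range_succ']
    simp only [List.take_succ_cons, List.drop_succ_cons, List.take_zero, List.drop_zero, preWord,
      postWord_cons, one_mul, word]
    have : ∀ i ∈ Finset.range (l.length + 1),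
        a * ι d * preWord ι a (l.take i) * (a' - a) * postWord ι a' (l.drop i) =
        a * ι d * (preWord ι a (l.take i) * (a' - a) * postWord ι a' (l.drop i)) := by
      intro i _; simp only [mul_assoc]
    rw [Finset.sum_congr rfl this, ← Finset.mul_sum, ← ih]
    noncomm_ring

lemma word_sub_word' (l : List D) :
    word ι a' l - word ι a l = ∑ i ∈ Finset.range (l.length + 1),
      preWord ι a' (l.take i) * (a' - a) * postWord ι a (l.drop i) := by
  have h := word_sub_word ι a' a l
  rw [← neg_sub, h, ← Finset.sum_neg_distrib]
  refine Finset.sum_congr rfl fun i _ => ?_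
  rw [← neg_sub a' a]
  noncomm_ring

lemma postWord_sub_postWord (l : List D) :
    postWord ι a' l - postWord ι a l = ∑ j ∈ Finset.range l.length,
      innerWord ι a' (l.take (j + 1)) * (a' - a) * postWord ι a (l.drop (j + 1)) := by
  cases l with
  | nil => simp [postWord]
  | cons d l =>
    simp only [List.length_cons, List.take_succ_cons, List.drop_succ_cons, innerWord,
      postWord_cons, ← mul_sub, word_sub_word' ι a a', Finset.mul_sum, mul_assoc]

lemma sum_range_ite_lt {M : Type*} [AddCommMonoid M] (i n : ℕ) (f : ℕ → M) :
    (∑ k ∈ Finset.range n, if i < k then f k else 0) =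
      ∑ j ∈ Finset.range (n - (i + 1)), f (i + 1 + j) := by
  rw [← Finset.sum_Ico_eq_sum_range, ← Finset.sum_filter]
  congr 1
  ext k
  simp only [Finset.mem_filter, Finset.mem_range, Finset.mem_Ico]
  omega

/-- The second order expansion of a word. -/
lemma word_sub_word_eq (l : List D) :
    word ι a' l - word ι a l =
      (∑ i ∈ Finset.range (l.length + 1),
        preWord ι a (l.take i) * (a' - a) * postWord ι a (l.drop i)) +
      ∑ i ∈ Finset.range (l.length + 1), ∑ k ∈ Finset.range (l.length + 1), if i < k then
        preWord ι a (l.take i) * (a' - a) * innerWord ι a' ((l.take k).drop i) * (a' - a) *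
          postWord ι a (l.drop k) else 0 := by
  rw [word_sub_word, ← Finset.sum_add_distrib]
  refine Finset.sum_congr rfl fun i _ => ?_
  -- The first expansion leaves new letters only to its right, and this part is expanded again from
  -- its right end. The inner word stays at the new value `a'`, so there is no third-order
  -- remainder.
  have h := postWord_sub_postWord ι a a' (l.drop i)
  rw [sub_eq_iff_eq_add'] at h
  rw [h, mul_add, sum_range_ite_lt, Finset.mul_sum, List.length_drop]
  congr 1
  have e : l.length + 1 - (i + 1) = l.length - i := by omega
  rw [e]
  refine Finset.sum_congr rfl fun j _ => ?_
  have e1 : i + 1 + j = i + (j + 1) := by omega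
  rw [List.drop_take, List.drop_drop, e1]
  have e2 : i + (j + 1) - i = j + 1 := by omega
  rw [e2]
  simp only [mul_assoc]

lemma continuous_preWord (l : List D) : Continuous fun a => preWord ι a l := by
  induction l with
  | nil => exact continuous_const
  | cons d l ih => exact (continuous_id.mul continuous_const).mul ih

lemma continuous_innerWord (l : List D) : Continuous fun a => innerWord ι a l := by
  cases l with
  | nil => exact continuous_const
  | cons d l => exact continuous_const.mul (continuous_preWord ι l)

lemma continuous_word (l : List D) : Continuous fun a => word ι a l := by
  simp only [← preWord_mul]
  exact (continuous_preWord ι l).mul continuous_id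

variable {ι a} {B : StarSubalgebra ℂ A} (hι : ∀ d, ι d ∈ B) (ha : a ∈ B)
include hι ha

lemma preWord_mem (l : List D) : preWord ι a l ∈ B := by
  induction l with
  | nil => exact one_mem _
  | cons d l ih => exact mul_mem (mul_mem ha (hι d)) ih

lemma postWord_mem (l : List D) : postWord ι a l ∈ B := by
  induction l with
  | nil => exact one_mem _
  | cons d l ih => exact mul_mem (mul_mem (hι d) ha) ih

lemma innerWord_mem (l : List D) : innerWord ι a l ∈ B := by
  cases l with
  | nil => exact one_mem _
  | cons d l => exact mul_mem (hι d) (preWord_mem hι ha l)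

end Words

/-! ### Boundary decompositions of triangular sums. -/

section Triangular

variable {M : Type*} [AddCommMonoid M] (n : ℕ) (g : ℕ → ℕ → M)

/-- The sum of `g i k` over `i < k < n`. -/
def triSum (n : ℕ) (g : ℕ → ℕ → M) : M :=
  ∑ i ∈ Finset.range n, ∑ k ∈ Finset.range n, if i < k then g i k else 0

lemma triSum_congr {n : ℕ} {g g' : ℕ → ℕ → M} (h : ∀ i k, i < k → k < n → g i k = g' i k) :
    triSum n g = triSum n g' := by
  refine Finset.sum_congr rfl fun i _ => Finset.sum_congr rfl fun k hk => ?_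
  split_ifs with hik
  · exact h i k hik (Finset.mem_range.1 hk)
  · rfl

lemma triSum_succ_last : triSum (n + 1) g = triSum n g + ∑ i ∈ Finset.range n, g i n := by
  unfold triSum
  rw [Finset.sum_range_succ]
  have h1 : (∑ k ∈ Finset.range (n + 1), if n < k then g n k else 0) = 0 :=
    Finset.sum_eq_zero fun k hk => if_neg (by have := Finset.mem_range.1 hk; omega)
  rw [h1, add_zero, ← Finset.sum_add_distrib]
  refine Finset.sum_congr rfl fun i hi => ?_
  rw [Finset.sum_range_succ, if_pos (Finset.mem_range.1 hi)]

lemma triSum_succ_first :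
    triSum (n + 1) g = triSum n (fun i k => g (i + 1) (k + 1)) + ∑ k ∈ Finset.range n, g 0 (k + 1) := by
  unfold triSum
  rw [Finset.sum_range_succ']
  congr 1
  · refine Finset.sum_congr rfl fun i _ => ?_
    rw [Finset.sum_range_succ']
    simp
  · rw [Finset.sum_range_succ']
    simp

lemma triSum_succ_diag :
    triSum (n + 1) g = triSum n (fun i k => g i (k + 1)) + ∑ i ∈ Finset.range n, g i (i + 1) := by
  induction n with
  | zero => simp [triSum]
  | succ n ih =>
    rw [triSum_succ_last, ih, triSum_succ_last n (fun i k => g i (k + 1)), Finset.sum_range_succ _ n,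
      Finset.sum_range_succ _ n]
    abel

/-- The left side runs over all `i ≤ k ≤ n`. The right side separates the pairs with `0 < i` and `k
< n` from the edges `k = n` and `i = 0` and the corner. -/
lemma triSum_succ_add_diag :
    triSum (n + 1) g + ∑ i ∈ Finset.range (n + 1), g i i =
      triSum n (fun i k => g (i + 1) k) + ∑ i ∈ Finset.range n, g (i + 1) n +
        ∑ k ∈ Finset.range n, g 0 k + g 0 n := by
  induction n with
  | zero => simp [triSum]
  | succ n ih =>
    have h1 : triSum (n + 1 + 1) g = triSum (n + 1) g + (∑ i ∈ Finset.range n, g (i + 1) (n + 1)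
        + g 0 (n + 1)) := by rw [triSum_succ_last, Finset.sum_range_succ' _ n]
    rw [h1, Finset.sum_range_succ _ (n + 1), triSum_succ_last n (fun i k => g (i + 1) k),
      Finset.sum_range_succ (fun i => g (i + 1) (n + 1)), Finset.sum_range_succ (fun k => g 0 k)]
    calc _ = (triSum (n + 1) g + ∑ i ∈ Finset.range (n + 1), g i i) +
          (∑ i ∈ Finset.range n, g (i + 1) (n + 1) + g 0 (n + 1) + g (n + 1) (n + 1)) := by abel
      _ = _ := by rw [ih]; abel

end Triangular

/-! ### The right slope of a moment. -/

section Hierarchy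

variable {D A : Type*} [CStarAlgebra D] [PartialOrder D] [StarOrderedRing D]
  [CStarAlgebra A] [PartialOrder A] [StarOrderedRing A]
  {ι : D →⋆ₐ[ℂ] A} {E : A →ₚ[ℂ] D} {B : StarSubalgebra ℂ A}

/-- The anticommutator part of the Lindbladian cancels in this combination, and likewise in
`dressedDefect`. Thus `σ 1` survives only in the linear part. -/
lemma two_smul_dressedLindbladian (σ : D → D) (Δ d₁ d₂ : D) :
    (2 : ℂ) • dressedLindbladian (lindbladian σ) Δ d₁ d₂ =
      σ (d₁ * Δ) * d₂ - σ d₁ * Δ * d₂ + d₁ * σ (Δ * d₂) - d₁ * Δ * σ d₂ := by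
  simp only [dressedLindbladian, lindbladian, sub_mul, mul_sub, smul_mul_assoc, mul_smul_comm,
    add_mul, mul_add, mul_assoc]
  module

lemma two_smul_dressedDefect (σ : D → D) (Δ d₁ d₂ : D) :
    (2 : ℂ) • dressedDefect (lindbladian σ) d₁ d₂ Δ =
      σ (d₁ * Δ * d₂) - d₁ * σ (Δ * d₂) - σ (d₁ * Δ) * d₂ + d₁ * σ Δ * d₂ := by
  simp only [dressedDefect, lindbladian, sub_mul, mul_sub, smul_mul_assoc, mul_smul_comm,
    add_mul, mul_add, mul_assoc]
  module

/-- The slope of `E (word ι φ_t Δ)` given by the first and second order expansions of the flow. -/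
def flowSlope (ι : D →⋆ₐ[ℂ] A) (E : A →ₚ[ℂ] D) (σ : D → D) (φ : A) (Δ : List D) : D :=
  (∑ i ∈ Finset.range (Δ.length + 1),
    (E (preWord ι φ (Δ.take i) * ι (σ (E φ)) * postWord ι φ (Δ.drop i))
      - (1 / 2 : ℂ) • (E (preWord ι φ (Δ.take i) * ι (σ 1) * φ * postWord ι φ (Δ.drop i))
        + E (preWord ι φ (Δ.take i) * φ * ι (σ 1) * postWord ι φ (Δ.drop i))))) +
  triSum (Δ.length + 1) fun i k =>
    E (preWord ι φ (Δ.take i) * ι (σ (E (φ * innerWord ι φ ((Δ.take k).drop i) * φ))) *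
        postWord ι φ (Δ.drop k))
    + E (preWord ι φ (Δ.take i) * φ * ι (σ (E (innerWord ι φ ((Δ.take k).drop i)))) * φ *
        postWord ι φ (Δ.drop k))
    - E (preWord ι φ (Δ.take i) * ι (σ (E (φ * innerWord ι φ ((Δ.take k).drop i)))) * φ *
        postWord ι φ (Δ.drop k))
    - E (preWord ι φ (Δ.take i) * φ * ι (σ (E (innerWord ι φ ((Δ.take k).drop i) * φ))) *
        postWord ι φ (Δ.drop k))

lemma IsSlope.ite {t : ℝ} {f : ℝ → D} {d : D} (h : IsSlope t f d) (P : Prop) [Decidable P] :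
    IsSlope t (fun s => if P then f s else 0) (if P then d else 0) := by
  split_ifs
  · exact h
  · exact isSlope_zero_iff.2 (Asymptotics.isLittleO_zero _ _)

lemma HasExpansion.isSlope_word {σ : D →CP D} {t : ℝ} {U V J K : ℝ → A} {u v : A}
    (h : HasExpansion ι E σ B t U V J K u v) (hι : ∀ d, ι d ∈ B) (φ₀ : D) (Δ : List D) :
    IsSlope t (fun s => E (word ι (U s * ι φ₀ * V s) Δ) - E (word ι (u * ι φ₀ * v) Δ))
      (flowSlope ι E σ (u * ι φ₀ * v) Δ) := by
  have hφ : u * ι φ₀ * v ∈ B := mul_mem (mul_mem h.mem_left (hι _)) h.mem_right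
  have htend : Tendsto (fun s => U s * ι φ₀ * V s) (𝓝[>] t) (𝓝 (u * ι φ₀ * v)) := by
    have := ((h.negligible_flow (hι φ₀)).tendsto.add (h.small_flow (hι φ₀)).tendsto).add_const
      (u * ι φ₀ * v)
    simpa using this
  have h1 := IsSlope.sum (S := Finset.range (Δ.length + 1))
    fun i _ => h.isSlope_first (hι φ₀) (preWord_mem hι hφ (Δ.take i))
      (postWord_mem hι hφ (Δ.drop i))
  have h2 := fun i k => h.isSlope_second (hι φ₀)
    (preWord_mem hι hφ (Δ.take i)) (innerWord_mem hι hφ ((Δ.take k).drop i))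
    (postWord_mem hι hφ (Δ.drop k))
    (((continuous_innerWord ι ((Δ.take k).drop i)).tendsto _).comp htend)
  have h3 := IsSlope.sum (S := Finset.range (Δ.length + 1)) fun i _ =>
    IsSlope.sum (S := Finset.range (Δ.length + 1)) fun k _ => (h2 i k).ite (i < k)
  have h4 := h1.add h3
  convert h4 using 2 with s
  · rw [← map_sub, word_sub_word_eq, map_add, map_sum, map_sum]
    congr 1
    refine Finset.sum_congr rfl fun i _ => ?_
    rw [map_sum]
    refine Finset.sum_congr rfl fun k _ => ?_
    split_ifs
    · rfl
    · simp
  · rw [flowSlope, triSum]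

end Hierarchy

/-! ### Identification of the slope with the hierarchy. -/

section Matching

lemma triSum_add {M : Type*} [AddCommMonoid M] (n : ℕ) (g g' : ℕ → ℕ → M) :
    triSum n (fun i k => g i k + g' i k) = triSum n g + triSum n g' := by
  simp only [triSum, ← Finset.sum_add_distrib]
  refine Finset.sum_congr rfl fun i _ => Finset.sum_congr rfl fun k _ => ?_
  split_ifs <;> simp

lemma triSum_sub {M : Type*} [AddCommGroup M] (n : ℕ) (g g' : ℕ → ℕ → M) :
    triSum n (fun i k => g i k - g' i k) = triSum n g - triSum n g' := by
  simp only [triSum, ← Finset.sum_sub_distrib]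
  refine Finset.sum_congr rfl fun i _ => Finset.sum_congr rfl fun k _ => ?_
  split_ifs <;> simp

section Lists

variable {α : Type*} (l : List α) (z : α) {i k : ℕ}

lemma take_succ_eq (hi : i < l.length) : l.take (i + 1) = l.take i ++ [l.getD i z] := by
  rw [List.take_add_one, List.getElem?_eq_getElem hi, List.getD_eq_getElem _ _ hi]
  rfl

lemma drop_eq_cons (hk : k < l.length) : l.drop k = l.getD k z :: l.drop (k + 1) := by
  rw [List.drop_eq_getElem_cons hk, List.getD_eq_getElem _ _ hk]

lemma drop_take_eq_cons (hik : i < k) (hk : k ≤ l.length) :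
    (l.take k).drop i = l.getD i z :: (l.take k).drop (i + 1) := by
  rw [drop_eq_cons (l.take k) z (by simp; omega)]
  congr 1
  rw [List.getD_eq_getElem _ _ (by simp; omega), List.getD_eq_getElem _ _ (by omega),
    List.getElem_take]

lemma drop_take_succ_eq (hik : i ≤ k) (hk : k < l.length) :
    (l.take (k + 1)).drop i = (l.take k).drop i ++ [l.getD k z] := by
  rw [take_succ_eq l z hk, List.drop_append_of_le_length (by simp; omega)]

end Lists

variable {D A : Type*} [CStarAlgebra D] [PartialOrder D] [StarOrderedRing D]
  [CStarAlgebra A] [PartialOrder A] [StarOrderedRing A]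
  {ι : D →⋆ₐ[ℂ] A} {E : A →ₚ[ℂ] D}

variable (ι E) in
/-- The moment of the word obtained from `Δ` by replacing `Δ_i, …, Δ_k` by the letter `y`. -/
def replaceMoment (φ : A) (Δ : List D) (i k : ℕ) (y : D) : D :=
  E (word ι φ (Δ.take i) * ι y * word ι φ (Δ.drop (k + 1)))

variable {φ : A} {Δ : List D} {i k : ℕ}

lemma replaceMoment_add (x y : D) : replaceMoment ι E φ Δ i k (x + y) =
    replaceMoment ι E φ Δ i k x + replaceMoment ι E φ Δ i k y := by
  simp [replaceMoment, mul_add, add_mul]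

lemma replaceMoment_sub (x y : D) : replaceMoment ι E φ Δ i k (x - y) =
    replaceMoment ι E φ Δ i k x - replaceMoment ι E φ Δ i k y := by
  simp [replaceMoment, mul_sub, sub_mul]

lemma replaceMoment_smul (r : ℂ) (x : D) : replaceMoment ι E φ Δ i k (r • x) =
    r • replaceMoment ι E φ Δ i k x := by
  simp [replaceMoment]

lemma linearPart_eq (σ : D → D) :
    linearPart (lindbladian σ) (fun l => E (word ι φ l)) Δ =
      σ (E (word ι φ Δ)) - (1 / 2 : ℂ) • (σ 1 * E (word ι φ Δ) + E (word ι φ Δ) * σ 1)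
      + ∑ j ∈ Finset.range Δ.length, (replaceMoment ι E φ Δ j j (σ (Δ.getD j 0))
        - (1 / 2 : ℂ) • (replaceMoment ι E φ Δ j j (σ 1 * Δ.getD j 0)
          + replaceMoment ι E φ Δ j j (Δ.getD j 0 * σ 1))) := by
  rw [linearPart, Finset.sum_range]
  congr 1
  refine Finset.sum_congr rfl fun j _ => ?_
  have hj : Δ.getD j 0 = Δ[j] := List.getD_eq_getElem _ _ j.2
  rw [hj, ← replaceMoment_add, ← replaceMoment_smul, ← replaceMoment_sub, replaceMoment,
    ← word_append_cons, List.set_eq_take_append_cons_drop, if_pos j.2]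
  rfl

lemma nonlinearPart_eq (σ : D → D) :
    nonlinearPart (lindbladian σ) (fun l => E (word ι φ l)) Δ =
      -∑ j ∈ Finset.range Δ.length,
        (σ (E (word ι φ (Δ.take j)) * Δ.getD j 0) * E (word ι φ (Δ.drop (j + 1)))
          - σ (E (word ι φ (Δ.take j))) * Δ.getD j 0 * E (word ι φ (Δ.drop (j + 1)))
          + E (word ι φ (Δ.take j)) * σ (Δ.getD j 0 * E (word ι φ (Δ.drop (j + 1))))
          - E (word ι φ (Δ.take j)) * Δ.getD j 0 * σ (E (word ι φ (Δ.drop (j + 1)))))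
      + triSum Δ.length fun i k =>
        replaceMoment ι E φ Δ i k
          (σ (Δ.getD i 0 * E (word ι φ ((Δ.take k).drop (i + 1))) * Δ.getD k 0))
        - replaceMoment ι E φ Δ i k
          (Δ.getD i 0 * σ (E (word ι φ ((Δ.take k).drop (i + 1))) * Δ.getD k 0))
        - replaceMoment ι E φ Δ i k
          (σ (Δ.getD i 0 * E (word ι φ ((Δ.take k).drop (i + 1)))) * Δ.getD k 0)
        + replaceMoment ι E φ Δ i k
          (Δ.getD i 0 * σ (E (word ι φ ((Δ.take k).drop (i + 1)))) * Δ.getD k 0) := by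
  have hj : ∀ j : Fin Δ.length, Δ.getD j 0 = Δ[j] := fun j => List.getD_eq_getElem _ _ j.2
  rw [nonlinearPart, neg_smul, Finset.smul_sum, Finset.smul_sum, triSum, Finset.sum_range,
    Finset.sum_range]
  congr 1
  · congr 1
    refine Finset.sum_congr rfl fun j _ => ?_
    rw [two_smul_dressedLindbladian, hj]
  · refine Finset.sum_congr rfl fun i _ => ?_
    rw [Finset.smul_sum, Finset.sum_range]
    refine Finset.sum_congr rfl fun k _ => ?_
    simp only [Fin.lt_def]
    split_ifs with hik
    · rw [hj, hj, ← replaceMoment_sub, ← replaceMoment_sub, ← replaceMoment_add,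
        ← two_smul_dressedDefect, replaceMoment_smul, replaceMoment, ← word_append_cons]
    · simp

/-- The positions `0, …, p` of the letters `φ` exceed the letters of `Δ` by one. Each kind of
contraction therefore produces a sum over pairs of letters of `Δ`, matching one term of the defect,
plus edge terms, matching the dressed Lindbladian and the linear part. -/
lemma flowSlope_eq (hE : IsCondExp ι E) (σ : D → D) :
    flowSlope ι E σ φ Δ =
      linearPart (lindbladian σ) (fun l => E (word ι φ l)) Δ
        + nonlinearPart (lindbladian σ) (fun l => E (word ι φ l)) Δ := by
  have hpre : ∀ i < Δ.length, preWord ι φ (Δ.take (i + 1)) =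
      word ι φ (Δ.take i) * ι (Δ.getD i 0) := fun i hi => by
    rw [take_succ_eq Δ 0 hi, preWord_concat]
  have hpost : ∀ k < Δ.length, postWord ι φ (Δ.drop k) =
      ι (Δ.getD k 0) * word ι φ (Δ.drop (k + 1)) := fun k hk => by
    rw [drop_eq_cons Δ 0 hk, postWord_cons]
  -- The first-order Itô correction `σ (E φ)` is the missing diagonal `i = k`. The edges give two
  -- terms of the dressed Lindbladian, and the corner gives `σ (E (word ι φ Δ))`.
  have hA : triSum (Δ.length + 1) (fun i k => E (preWord ι φ (Δ.take i) *
        ι (σ (E (φ * innerWord ι φ ((Δ.take k).drop i) * φ))) * postWord ι φ (Δ.drop k)))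
      + ∑ i ∈ Finset.range (Δ.length + 1),
        E (preWord ι φ (Δ.take i) * ι (σ (E φ)) * postWord ι φ (Δ.drop i))
      = triSum Δ.length (fun i k => replaceMoment ι E φ Δ i k
          (Δ.getD i 0 * σ (E (word ι φ ((Δ.take k).drop (i + 1)))) * Δ.getD k 0))
        + ∑ j ∈ Finset.range Δ.length,
          E (word ι φ (Δ.take j)) * Δ.getD j 0 * σ (E (word ι φ (Δ.drop (j + 1))))
        + ∑ j ∈ Finset.range Δ.length,
          σ (E (word ι φ (Δ.take j))) * Δ.getD j 0 * E (word ι φ (Δ.drop (j + 1)))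
        + σ (E (word ι φ Δ)) := by
    have h := triSum_succ_add_diag Δ.length (fun i k => E (preWord ι φ (Δ.take i) *
      ι (σ (E (word ι φ ((Δ.take k).drop i)))) * postWord ι φ (Δ.drop k)))
    convert h using 1
    · congr 1
      · refine triSum_congr fun i k hik hk => ?_
        rw [drop_take_eq_cons Δ 0 hik (by omega), mul_assoc φ, innerWord_cons_mul, word]
        simp only [mul_assoc]
      · refine Finset.sum_congr rfl fun i _ => ?_
        have e : (Δ.take i).drop i = [] := List.drop_eq_nil_of_le (by simp)
        simp only [e, word]
    · congr 1
      · congr 1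
        · congr 1
          · refine triSum_congr fun i k hik hk => ?_
            rw [hpre i (by omega), hpost k hk, replaceMoment]
            simp only [map_mul, mul_assoc]
          · refine Finset.sum_congr rfl fun j hj => ?_
            rw [hpre j (Finset.mem_range.1 hj)]
            simp only [List.take_length, List.drop_length, postWord, mul_one]
            rw [hE.map_mul_coe, hE.map_mul_coe]
        · refine Finset.sum_congr rfl fun j hj => ?_
          rw [hpost j (Finset.mem_range.1 hj)]
          simp only [List.take_zero, List.drop_zero, preWord, one_mul]
          rw [hE.map_coe_mul, hE.map_coe_mul, mul_assoc]
      · simp [preWord, postWord, hE.map_coe]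
  -- For adjacent positions the inner word is a single letter of `Δ`, which gives the `σ (Δ_j)` of
  -- the linear part.
  have hB : triSum (Δ.length + 1) (fun i k => E (preWord ι φ (Δ.take i) * φ *
        ι (σ (E (innerWord ι φ ((Δ.take k).drop i)))) * φ * postWord ι φ (Δ.drop k)))
      = triSum Δ.length (fun i k => replaceMoment ι E φ Δ i k
          (σ (Δ.getD i 0 * E (word ι φ ((Δ.take k).drop (i + 1))) * Δ.getD k 0)))
        + ∑ j ∈ Finset.range Δ.length, replaceMoment ι E φ Δ j j (σ (Δ.getD j 0)) := by
    rw [triSum_succ_diag]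
    congr 1
    · refine triSum_congr fun i k hik hk => ?_
      rw [drop_take_succ_eq Δ 0 hik.le hk, drop_take_eq_cons Δ 0 hik hk.le, List.cons_append,
        innerWord_cons_concat, hE.bimodule, preWord_mul, mul_assoc _ φ, mul_postWord]
      rfl
    · refine Finset.sum_congr rfl fun j hj => ?_
      rw [drop_take_succ_eq Δ 0 le_rfl (Finset.mem_range.1 hj),
        List.drop_eq_nil_of_le (by simp), List.nil_append, innerWord, preWord, mul_one, hE.map_coe,
        preWord_mul, mul_assoc _ φ, mul_postWord]
      rfl
  -- Here the edge is `i = 0`, where nothing precedes `σ` and `E` factorizes. In `hD` it is `k =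
  -- Δ.length`, where nothing follows.
  have hC : triSum (Δ.length + 1) (fun i k => E (preWord ι φ (Δ.take i) *
        ι (σ (E (φ * innerWord ι φ ((Δ.take k).drop i)))) * φ * postWord ι φ (Δ.drop k)))
      = triSum Δ.length (fun i k => replaceMoment ι E φ Δ i k
          (Δ.getD i 0 * σ (E (word ι φ ((Δ.take k).drop (i + 1))) * Δ.getD k 0)))
        + ∑ j ∈ Finset.range Δ.length,
          σ (E (word ι φ (Δ.take j)) * Δ.getD j 0) * E (word ι φ (Δ.drop (j + 1))) := by
    rw [triSum_succ_first]
    congr 1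
    · refine triSum_congr fun i k hik hk => ?_
      rw [drop_take_succ_eq Δ 0 hik hk, mul_innerWord_concat, hE.map_mul_coe, hpre i (by omega),
        mul_assoc _ φ, mul_postWord, replaceMoment]
      simp only [map_mul, mul_assoc]
    · refine Finset.sum_congr rfl fun j hj => ?_
      rw [drop_take_succ_eq Δ 0 (Nat.zero_le _) (Finset.mem_range.1 hj), mul_innerWord_concat,
        hE.map_mul_coe, mul_assoc _ φ, mul_postWord]
      simp only [List.take_zero, List.drop_zero, preWord, one_mul]
      rw [hE.map_coe_mul]
  have hD : triSum (Δ.length + 1) (fun i k => E (preWord ι φ (Δ.take i) * φ *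
        ι (σ (E (innerWord ι φ ((Δ.take k).drop i) * φ))) * postWord ι φ (Δ.drop k)))
      = triSum Δ.length (fun i k => replaceMoment ι E φ Δ i k
          (σ (Δ.getD i 0 * E (word ι φ ((Δ.take k).drop (i + 1)))) * Δ.getD k 0))
        + ∑ j ∈ Finset.range Δ.length,
          E (word ι φ (Δ.take j)) * σ (Δ.getD j 0 * E (word ι φ (Δ.drop (j + 1)))) := by
    rw [triSum_succ_last]
    congr 1
    · refine triSum_congr fun i k hik hk => ?_
      rw [drop_take_eq_cons Δ 0 hik hk.le, innerWord_cons_mul, hE.map_coe_mul, preWord_mul,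
        hpost k hk, replaceMoment]
      simp only [map_mul, mul_assoc]
    · refine Finset.sum_congr rfl fun j hj => ?_
      rw [drop_take_eq_cons Δ 0 (Finset.mem_range.1 hj) le_rfl, innerWord_cons_mul,
        hE.map_coe_mul, preWord_mul]
      simp only [List.take_length, List.drop_length, postWord, mul_one]
      rw [hE.map_mul_coe]
  have hQ₁ : ∑ i ∈ Finset.range (Δ.length + 1),
        E (preWord ι φ (Δ.take i) * ι (σ 1) * φ * postWord ι φ (Δ.drop i))
      = ∑ j ∈ Finset.range Δ.length, replaceMoment ι E φ Δ j j (Δ.getD j 0 * σ 1)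
        + σ 1 * E (word ι φ Δ) := by
    rw [Finset.sum_range_succ']
    congr 1
    · refine Finset.sum_congr rfl fun j hj => ?_
      rw [hpre j (Finset.mem_range.1 hj), mul_assoc _ φ, mul_postWord, replaceMoment]
      simp only [map_mul, mul_assoc]
    · rw [mul_assoc _ φ, mul_postWord]
      simp [preWord, hE.map_coe_mul]
  have hQ₂ : ∑ i ∈ Finset.range (Δ.length + 1),
        E (preWord ι φ (Δ.take i) * φ * ι (σ 1) * postWord ι φ (Δ.drop i))
      = ∑ j ∈ Finset.range Δ.length, replaceMoment ι E φ Δ j j (σ 1 * Δ.getD j 0)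
        + E (word ι φ Δ) * σ 1 := by
    rw [Finset.sum_range_succ]
    congr 1
    · refine Finset.sum_congr rfl fun j hj => ?_
      rw [hpost j (Finset.mem_range.1 hj), preWord_mul, replaceMoment]
      simp only [map_mul, mul_assoc]
    · rw [preWord_mul]
      simp [postWord, hE.map_mul_coe]
  rw [flowSlope, triSum_sub, triSum_sub, triSum_add, hB, hC, hD, Finset.sum_sub_distrib,
    ← Finset.smul_sum, Finset.sum_add_distrib, hQ₁, hQ₂, linearPart_eq, nonlinearPart_eq,
    triSum_add, triSum_sub, triSum_sub]
  rw [← eq_sub_iff_add_eq] at hA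
  rw [hA]
  simp only [Finset.sum_sub_distrib, Finset.sum_add_distrib, ← Finset.smul_sum]
  module

end Matching

/-! ### From right derivatives to derivatives, and the main theorem. -/

section Main

/-- A continuous function with a continuous right derivative is differentiable. -/
lemma hasDerivWithinAt_Ici_of_right {V : Type*} [NormedAddCommGroup V] [NormedSpace ℝ V]
    [CompleteSpace V] {f g : ℝ → V} (hf : ContinuousOn f (Ici 0)) (hg : ContinuousOn g (Ici 0))
    (h : ∀ t, 0 ≤ t → HasDerivWithinAt f (g t) (Ici t) t) {t : ℝ} (ht : 0 ≤ t) :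
    HasDerivWithinAt f (g t) (Ici 0) t := by
  -- Freezing `g` at `g 0` for negative times makes it continuous on the line, so its primitive `F`
  -- is differentiable everywhere. Then `f - F` has zero right derivative, hence is constant on `[0,
  -- ∞)`.
  have hgc : Continuous fun s => g (max s 0) :=
    hg.comp_continuous (by fun_prop) fun s => le_max_right s 0
  set F : ℝ → V := fun s => ∫ u in (0 : ℝ)..s, g (max u 0) with hF
  have hFd : ∀ s, HasDerivAt F (g (max s 0)) s := fun s =>
    intervalIntegral.integral_hasDerivAt_right (hgc.intervalIntegrable _ _)
      (hgc.stronglyMeasurableAtFilter _ _) hgc.continuousAt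
  have hconst : ∀ s, 0 ≤ s → f s = f 0 + F s := by
    intro s hs
    have := constant_of_has_deriv_right_zero (f := fun s => f s - F s) (a := 0) (b := s)
      ((hf.mono Icc_subset_Ici_self).sub fun x _ => (hFd x).continuousAt.continuousWithinAt)
      (fun x hx => by
        have := (h x hx.1).sub (hFd x).hasDerivWithinAt
        rwa [max_eq_left hx.1, sub_self] at this) s ⟨hs, le_rfl⟩
    simp only [hF, intervalIntegral.integral_same, sub_zero] at this
    rw [← this, hF]
    simp
  have h1 : HasDerivWithinAt (fun s => f 0 + F s) (g t) (Ici 0) t := by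
    have := ((hFd t).const_add (f 0)).hasDerivWithinAt (s := Ici 0)
    rwa [max_eq_left ht] at this
  exact h1.congr (fun s hs => hconst s hs) (hconst t ht)

lemma IsSlope.hasDerivWithinAt {V : Type*} [NormedAddCommGroup V] [NormedSpace ℝ V]
    {f : ℝ → V} {d : V} {t : ℝ} (h : IsSlope t (fun s => f s - f t) d) :
    HasDerivWithinAt f d (Ici t) t := by
  rw [← hasDerivWithinAt_Ioi_iff_Ici, hasDerivWithinAt_iff_isLittleO]
  exact h

lemma linearPart_congr {D : Type*} [CStarAlgebra D] (L : D → D) {C C' : List D → D} {Δ : List D}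
    (h : ∀ l, l.length = Δ.length → C l = C' l) : linearPart L C Δ = linearPart L C' Δ := by
  rw [linearPart, linearPart, h Δ rfl]
  congr 1
  exact Finset.sum_congr rfl fun j _ => h _ (by simp)

lemma nonlinearPart_congr {D : Type*} [CStarAlgebra D] (L : D → D) {C C' : List D → D}
    {Δ : List D} (h : ∀ l, l.length < Δ.length → C l = C' l) :
    nonlinearPart L C Δ = nonlinearPart L C' Δ := by
  have h1 : ∀ j : Fin Δ.length, C (Δ.take j) = C' (Δ.take j) := fun j => h _ (by simp)
  have h2 : ∀ j : Fin Δ.length, C (Δ.drop (j + 1)) = C' (Δ.drop (j + 1)) := fun j =>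
    h _ (by have := j.2; simp; omega)
  rw [nonlinearPart, nonlinearPart]
  congr 2
  · exact Finset.sum_congr rfl fun j _ => by rw [h1, h2]
  · refine Finset.sum_congr rfl fun j _ => Finset.sum_congr rfl fun k _ => ?_
    split_ifs with hjk
    · have hk := k.2
      have hj := j.2
      have hjk' : (j : ℕ) < k := hjk
      rw [h ((Δ.take k).drop (j + 1)) (by simp; omega)]
      exact h _ (by simp; omega)
    · rfl

variable {D A : Type*} [CStarAlgebra D] [PartialOrder D] [StarOrderedRing D]
  [CStarAlgebra A] [PartialOrder A] [StarOrderedRing A]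
  {ι : D →⋆ₐ[ℂ] A} {E : A →ₚ[ℂ] D} {σ : D →CP D} {X U V : ℝ → A}

lemma continuous_postWord (l : List D) : Continuous fun a => postWord ι a l := by
  induction l with
  | nil => exact continuous_const
  | cons d l ih => exact (continuous_const.mul continuous_id).mul ih

lemma continuous_flowSlope (Δ : List D) : Continuous fun φ => flowSlope ι E σ φ Δ := by
  have hE : Continuous E := map_continuous E
  have hσ : Continuous σ := continuous_cp σ
  have hι : Continuous ι := map_continuous ι
  have h1 := continuous_preWord ι
  have h2 := continuous_postWord (ι := ι)
  have h3 := continuous_innerWord ι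
  unfold flowSlope triSum
  refine (continuous_finsetSum _ fun i _ => ?_).add
    (continuous_finsetSum _ fun i _ => continuous_finsetSum _ fun k _ => ?_)
  · fun_prop
  · split_ifs <;> fun_prop

/-- Spectral permanence for C*-subalgebras. It makes the inverse of `U t` adapted. -/
lemma mem_of_mul_eq_one {S : StarSubalgebra ℂ A} (hS : IsClosed (S : Set A)) {u v : A}
    (hu : u ∈ S) (h₁ : u * v = 1) (h₂ : v * u = 1) : v ∈ S := by
  have := StarSubalgebra.coe_isUnit (S := S) (hS := hS) (a := ⟨u, hu⟩)
  obtain ⟨w, hw⟩ := (this.1 (isUnit_iff_exists.2 ⟨v, h₁, h₂⟩)).exists_left_inv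
  have hw' : (w : A) * u = 1 := congrArg Subtype.val hw
  rw [← left_inv_eq_right_inv hw' h₁]
  exact w.2

lemma continuousOn_of_inverse {s : Set ℝ} (hU : ContinuousOn U s)
    (h : ∀ t ∈ s, U t * V t = 1 ∧ V t * U t = 1) : ContinuousOn V s := by
  have hV : ∀ t ∈ s, V t = Ring.inverse (U t) := fun t ht =>
    (Ring.inverse_unit ⟨U t, V t, (h t ht).1, (h t ht).2⟩).symm
  refine ContinuousOn.congr (fun t ht => ?_) hV
  have hc : ContinuousAt Ring.inverse (U t) :=
    NormedRing.inverse_continuousAt ⟨U t, V t, (h t ht).1, (h t ht).2⟩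
  exact hc.comp_continuousWithinAt (hU t ht)

lemma IsEvolution.hasDerivWithinAt_moment (hE : IsCondExp ι E)
    (hX : IsFreeBrownianMotion ι E σ X) (hU : IsEvolution ι σ X U) {φ₀ : D} {φ : ℝ → A}
    (hφ : IsOrbitFlow ι U φ₀ φ) (Δ : List D) {t : ℝ} (ht : 0 ≤ t) :
    HasDerivWithinAt (fun s => moment ι E φ s Δ)
      (linearPart (lindbladian σ) (moment ι E φ t) Δ
        + nonlinearPart (lindbladian σ) (moment ι E φ t) Δ) (Ici 0) t := by
  obtain ⟨V, hV, hφV⟩ := hφ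
  have hVc : ContinuousOn V (Ici 0) := by
    rcases hV with hV | hV
    · exact continuousOn_of_inverse hU.continuousOn hV
    · exact hU.continuousOn.star.congr hV
  -- `V` is known to be the adjoint of `U` only at nonnegative times, whereas the expansion is
  -- stated for the function `r ↦ star (U r)`. Hence the auxiliary `V'`.
  have hexp : ∀ s, 0 ≤ s → ∃ V' J K, (∀ r, 0 ≤ r → V' r = V r) ∧
      HasExpansion ι E σ (filtration ι X s) s U V' J K (U s) (V s) := by
    intro s hs
    rcases hV with hV | hV
    · refine ⟨V, _, _, fun _ _ => rfl, hU.hasExpansion_inverse hE hX hs hV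
        (mem_of_mul_eq_one (StarSubalgebra.isClosed_topologicalClosure _) (hU.adapted s hs)
          (hV s hs).1 (hV s hs).2) ?_⟩
      exact ((hVc s hs).mono fun x (hx : s < x) => hs.trans hx.le).tendsto
    · rw [hV s hs]
      exact ⟨fun r => star (U r), _, _, fun r hr => (hV r hr).symm, hU.hasExpansion_star hE hX hs⟩
  have hφc : ContinuousOn φ (Ici 0) :=
    ((hU.continuousOn.mul continuousOn_const).mul hVc).congr hφV
  have hEc : Continuous E := map_continuous E
  have hflow : ∀ s, linearPart (lindbladian σ) (moment ι E φ s) Δ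
      + nonlinearPart (lindbladian σ) (moment ι E φ s) Δ = flowSlope ι E σ (φ s) Δ :=
    fun s => (flowSlope_eq hE σ).symm
  rw [hflow]
  refine hasDerivWithinAt_Ici_of_right (g := fun s => flowSlope ι E σ (φ s) Δ)
    ((hEc.comp (continuous_word ι Δ)).comp_continuousOn hφc)
    ((continuous_flowSlope Δ).comp_continuousOn hφc) (fun s hs => ?_) ht
  obtain ⟨V', J, K, hV', h⟩ := hexp s hs
  refine IsSlope.hasDerivWithinAt ?_
  have h1 := h.isSlope_word (coe_mem_filtration s) φ₀ Δ
  rw [← hφV s hs] at h1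
  refine h1.congr' ?_
  filter_upwards [self_mem_nhdsWithin] with r hr
  have hr0 : 0 ≤ r := hs.trans (le_of_lt hr)
  rw [hV' r hr0, ← hφV r hr0]
  rfl

end Main

end FreeOrbit

end

theorem mainTheorem3 {D A : Type*}
    [CStarAlgebra D] [PartialOrder D] [StarOrderedRing D]
    [CStarAlgebra A] [PartialOrder A] [StarOrderedRing A]
    (ι : D →⋆ₐ[ℂ] A) (E : A →ₚ[ℂ] D) (hE : FreeOrbit.IsCondExp ι E)
    (σ : D →CP D) (X : ℝ → A) (hX : FreeOrbit.IsFreeBrownianMotion ι E σ X)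
    (U : ℝ → A) (hU : FreeOrbit.IsEvolution ι σ X U)
    (φ₀ : D) (φ : ℝ → A) (hφ : FreeOrbit.IsOrbitFlow ι U φ₀ φ) :
    -- the evolution equations
    (∀ (Δ : List D) (t : ℝ), 0 ≤ t →
      HasDerivWithinAt (fun s => FreeOrbit.moment ι E φ s Δ)
        (FreeOrbit.linearPart (FreeOrbit.lindbladian σ) (FreeOrbit.moment ι E φ t) Δ
          + FreeOrbit.nonlinearPart (FreeOrbit.lindbladian σ) (FreeOrbit.moment ι E φ t) Δ)
        (Set.Ici 0) t) ∧
    -- the hierarchy is closed and triangular: at level `p + 1` the linear part involves `C_{p+1}`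
    -- only, and the nonlinear part involves `C_1, …, C_p` only
    (∀ (L : D → D) (C C' : List D → D) (Δ : List D),
      ((∀ l, l.length = Δ.length → C l = C' l) →
        FreeOrbit.linearPart L C Δ = FreeOrbit.linearPart L C' Δ) ∧
      ((∀ l, l.length < Δ.length → C l = C' l) →
        FreeOrbit.nonlinearPart L C Δ = FreeOrbit.nonlinearPart L C' Δ)) := by 
  exact ⟨fun Δ t ht => hU.hasDerivWithinAt_moment hE hX hφ Δ ht, fun L C C' Δ =>
    ⟨FreeOrbit.linearPart_congr L, FreeOrbit.nonlinearPart_congr L⟩⟩
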